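/- Let $n\ge 2$, $I=\{1,\dots,n-1\}$, and consider $\mathfrak{gl}_n$-crystals with weight lattice $P=\bigoplus_{i=1}^n\mathbb Z\epsilon_i$, simple roots $\alpha_i=\epsilon_i-\epsilon_{i+1}$ and simple coroots $h_i=e_{ii}-e_{i+1\,i+1}$ ($i\in I$). The tensor product rule is $$\mathrm{wt}(b_1\otimes b_2)=\mathrm{wt}(b_1)+\mathrm{wt}(b_2),$$ $$\varepsilon_i(b_1\otimes b_2)=\max\{\varepsilon_i(b_1),\varepsilon_i(b_2)-\langle\mathrm{wt}(b_1),h_i\rangle\},\qquad \varphi_i(b_1\otimes b_2)=\max\{\varphi_i(b_1)+\langle\mathrm{wt}(b_2),h_i\rangle,\varphi_i(b_2)\},$$ where $\tilde e_i(b_1\otimes b_2)$ is $\tilde e_ib_1\otimes b_2$ if $\varphi_i(b_1)\ge\varepsilon_i(b_2)$ and $b_1\otimes\tilde e_ib_2$ otherwise, and $\tilde f_i(b_1\otimes b_2)$ is $\tilde f_ib_1\otimes b_2$ if $\varphi_i(b_1)>\varepsilon_i(b_2)$ and $b_1\otimes\tilde f_ib_2$ otherwise. The set $[n]=\{1,\dots,n\}$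 is the crystal $B(\epsilon_1)$ with $\mathrm{wt}(k)=\epsilon_k$, and a finite word $a_1\cdots a_r$ in $[n]$ is identified with $a_1\otimes\cdots\otimes a_r$. Let $\mathcal M$ be the set of $n\times n$ matrices with entries in $\mathbb Z_{\ge0}$. For $M=(m_{ij})\in\mathcal M$, list the pairs $(i,j)$, each $m_{ij}$ times, by increasing $j$ and, for equal $j$, by decreasing $i$. If this list is $(a_1,b_1),\dots,(a_r,b_r)$, write $M=M(\mathbf a,\mathbf b)$ with $\mathbf a=a_1\cdots a_r$ and $\mathbf b=b_1\cdots b_r$. * The row structure on $\mathcal M$ is $\mathrm{wt}(M)=\mathrm{wt}(\mathbf a)$, $\varepsilon_i(M)=\varepsilon_i(\mathbf a)$, $\varphi_i(M)=\varphi_i(\mathbf a)$ and $\tilde x_iM=M(\tilde x_i\mathbf a,\mathbf b)$ for $x=e,f$ (which is $\mathbf 0$ if $\tilde x_i\mathbf a=\mathbf 0$). * The column structure is $\tilde x_i^\sharp M=(\tilde x_iM^t)^t$, $\mathrm{wt}^\sharp(M)=\mathrm{wt}(M^t)$, $\varepsilon_i^\sharp(M)=\varepsilon_i(M^t)$, $\varphi_i^\sharp(M)=\varphi_i(M^t)$.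 * The diagonal structure $\mathtt M$ on the set $\mathcal M$, with operators $\tilde{\mathtt e}_i,\tilde{\mathtt f}_i$, is given by the tensor product rule applied to the row structure (first factor) and the column structure (second factor). Thus $\tilde{\mathtt e}_iM=\tilde e_iM$ if $\varphi_i(M)\ge\varepsilon_i^\sharp(M)$ and $\tilde{\mathtt e}_iM=\tilde e_i^\sharp M$ otherwise, and $\tilde{\mathtt f}_iM=\tilde f_iM$ if $\varphi_i(M)>\varepsilon_i^\sharp(M)$ and $\tilde{\mathtt f}_iM=\tilde f_i^\sharp M$ otherwise; $\mathrm{wt}$, $\varepsilon_i$, $\varphi_i$ are given by the formulas above. Let $\mathscr P_n$ be the set of partitions $\lambda=(\lambda_1\ge\dots\ge\lambda_n\ge0)$. For $\lambda\in\mathscr P_n$ let $\mathtt C_\lambda$ be the connected component of $\mathrm{diag}(\lambda_1,\dots,\lambda_n)$ in $\mathtt M$, and let $B(\lambda)$ be the crystal of the irreducible highest weight module of highest weight $\lambda$, realized as the set of semistandard Young tableaux of shape $\lambda$ with entries in $[n]$, whose crystal structure is induced from words through the reading word (rows from top to bottom, each row from right to left). Let $\mathcal M^{low}=\{M\in\mathcal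 M : m_{ij}=0\text{ for }i<j\}$. 1. $\mathcal M^{low}\cup\{\mathbf 0\}$ is invariant under $\tilde{\mathtt e}_i$ and $\tilde{\mathtt f}_i$ for all $i\in I$, where $\tilde{\mathtt e}_i\mathbf 0=\tilde{\mathtt f}_i\mathbf 0=\mathbf 0$. 2. $\mathtt M$ is a crystal, $\mathcal M^{low}$ is a subcrystal of $\mathtt M$, and $$\mathcal M^{low}=\bigsqcup_{\lambda\in\mathscr P_n}\mathtt C_\lambda \quad\text{(disjoint union)}.$$ 3. For every $\lambda\in\mathscr P_n$, $\mathtt C_\lambda$ is isomorphic to $B(2\lambda)$ as a crystal. -/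

import Mathlib

/-!  Crystals for `gl n`.  The letters `1, …, n` are the elements of `Fin n`, the index set `I` of
simple roots is `Fin (n - 1)`, the weight lattice `P` is `Fin n → ℤ`, and the formal symbol `0` is
`none : Option B`. -/

namespace DiagCrystal

/-- The letter `i` of the simple root `α i = ε i - ε (i + 1)`. -/
def lo {n : ℕ} (i : Fin (n - 1)) : Fin n := ⟨i.1, by omega⟩

/-- The letter `i + 1` of the simple root `α i = ε i - ε (i + 1)`. -/
def hi {n : ℕ} (i : Fin (n - 1)) : Fin n := ⟨i.1 + 1, by omega⟩

/-- The simple root `α i`. -/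
def root {n : ℕ} (i : Fin (n - 1)) : Fin n → ℤ := Pi.single (lo i) 1 - Pi.single (hi i) 1

/-- The pairing `⟨μ, h i⟩` of a weight with the simple coroot `h i`. -/
def pairing {n : ℕ} (μ : Fin n → ℤ) (i : Fin (n - 1)) : ℤ := μ (lo i) - μ (hi i)

/-- The data of a crystal on the set `B`. The value `-∞` of `ε` and `φ` is not needed, since it
does not occur in any crystal below. -/
structure CrystalData (n : ℕ) (B : Type*) where
  wt : B → Fin n → ℤ
  eps : Fin (n - 1) → B → ℤ
  phi : Fin (n - 1) → B → ℤ
  e : Fin (n - 1) → B → Option B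
  f : Fin (n - 1) → B → Option B

namespace CrystalData

variable {n : ℕ} {B B' : Type*}

/-- The axioms of a crystal (the one on `φ = -∞` is void). -/
structure IsCrystal (C : CrystalData n B) : Prop where
  phi_eq : ∀ i b, C.phi i b = pairing (C.wt b) i + C.eps i b
  e_some : ∀ i b b', C.e i b = some b' →
    C.eps i b' = C.eps i b - 1 ∧ C.phi i b' = C.phi i b + 1 ∧ C.wt b' = C.wt b + root i
  f_some : ∀ i b b', C.f i b = some b' →
    C.eps i b' = C.eps i b + 1 ∧ C.phi i b' = C.phi i b - 1 ∧ C.wt b' = C.wt b - root i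
  f_iff_e : ∀ i b b', C.f i b = some b' ↔ C.e i b' = some b

/-- `S ∪ {0}` is invariant under all `e i` and `f i` (which send `0` to `0`). -/
def Stable (C : CrystalData n B) (S : Set B) : Prop :=
  ∀ i, ∀ b ∈ S, (∀ b', C.e i b = some b' → b' ∈ S) ∧ (∀ b', C.f i b = some b' → b' ∈ S)

/-- The structure induced along an injective map `g : B' → B`: `e i y` is the element which `g`
maps to `e i (g y)`, and it is `0` if `e i (g y)` is `0` or is not in the image of `g`
(the latter does not happen if the image is stable). -/
noncomputable def comap (C : CrystalData n B) (g : B' → B) : CrystalData n B' where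
  wt y := C.wt (g y)
  eps i y := C.eps i (g y)
  phi i y := C.phi i (g y)
  e i y := (C.e i (g y)).bind (Function.partialInv g)
  f i y := (C.f i (g y)).bind (Function.partialInv g)

/-- The restriction of the structure to a subset. -/
noncomputable def restrict (C : CrystalData n B) (S : Set B) : CrystalData n S :=
  C.comap (Subtype.val : S → B)

/-- `S` is a subcrystal of the crystal `C`. -/
structure IsSubcrystal (C : CrystalData n B) (S : Set B) : Prop where
  isCrystal : C.IsCrystal
  stable : C.Stable S
  restrict_isCrystal : (C.restrict S).IsCrystal

/-- The connected component of `b` in the crystal graph. -/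
def component (C : CrystalData n B) (b : B) : Set B :=
  {x | Relation.EqvGen (fun y z => ∃ i, C.f i y = some z ∨ C.e i y = some z) b x}

/-- An isomorphism of crystals: a bijection which respects all structure maps. -/
structure Iso (C : CrystalData n B) (C' : CrystalData n B') extends B ≃ B' where
  map_wt : ∀ b, C'.wt (toEquiv b) = C.wt b
  map_eps : ∀ i b, C'.eps i (toEquiv b) = C.eps i b
  map_phi : ∀ i b, C'.phi i (toEquiv b) = C.phi i b
  map_e : ∀ i b, C'.e i (toEquiv b) = (C.e i b).map toEquiv
  map_f : ∀ i b, C'.f i (toEquiv b) = (C.f i b).map toEquiv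

end CrystalData

/-! ### The crystal of words -/

section Words

variable {n : ℕ}

/-- The crystal `B(ε 1)` of letters: `f i` sends `i` to `i + 1`, and `e i` sends `i + 1` to `i`. -/
def letterCrystal (n : ℕ) : CrystalData n (Fin n) where
  wt k := Pi.single k 1
  eps i k := if k = hi i then 1 else 0
  phi i k := if k = lo i then 1 else 0
  e i k := if k = hi i then some (lo i) else none
  f i k := if k = lo i then some (hi i) else none

/-- The weight of a word. -/
def wordWt : List (Fin n) → Fin n → ℤ
  | [] => 0
  | a :: w => (letterCrystal n).wt a + wordWt w

/-- `ε` on `a ⊗ w` by the tensor product rule. -/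
def wordEps (i : Fin (n - 1)) : List (Fin n) → ℤ
  | [] => 0
  | a :: w => max ((letterCrystal n).eps i a) (wordEps i w - pairing ((letterCrystal n).wt a) i)

/-- `φ` on `a ⊗ w` by the tensor product rule. -/
def wordPhi (i : Fin (n - 1)) : List (Fin n) → ℤ
  | [] => 0
  | a :: w => max ((letterCrystal n).phi i a + pairing (wordWt w) i) (wordPhi i w)

/-- `e i` on `a ⊗ w` by the tensor product rule. -/
def wordE (i : Fin (n - 1)) : List (Fin n) → Option (List (Fin n))
  | [] => none
  | a :: w =>
    if wordEps i w ≤ (letterCrystal n).phi i a then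
      ((letterCrystal n).e i a).map fun a' => a' :: w
    else (wordE i w).map fun w' => a :: w'

/-- `f i` on `a ⊗ w` by the tensor product rule. -/
def wordF (i : Fin (n - 1)) : List (Fin n) → Option (List (Fin n))
  | [] => none
  | a :: w =>
    if wordEps i w < (letterCrystal n).phi i a then
      ((letterCrystal n).f i a).map fun a' => a' :: w
    else (wordF i w).map fun w' => a :: w'

/-- The crystal of finite words, `a₁ ⋯ a_r` being identified with `a₁ ⊗ ⋯ ⊗ a_r`. -/
def wordCrystal (n : ℕ) : CrystalData n (List (Fin n)) where
  wt := wordWt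
  eps := wordEps
  phi := wordPhi
  e := wordE
  f := wordF

end Words

/-! ### Partitions and the crystals `B(μ)` -/

/-- Partitions `λ₁ ≥ ⋯ ≥ λ_n ≥ 0` of length at most `n`. -/
def Partn (n : ℕ) : Type := {l : Fin n → ℕ // Antitone l}

/-- The partition `2 λ`. -/
def Partn.double {n : ℕ} (l : Partn n) : Partn n :=
  ⟨fun i => 2 * l.1 i, fun _ _ h => Nat.mul_le_mul_left 2 (l.2 h)⟩

/-- The Young diagram with `λ_i` cells in the `i`-th row. -/
def Partn.diagram {n : ℕ} (l : Partn n) : YoungDiagram :=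
  YoungDiagram.ofRowLens (List.ofFn l.1) l.2.sortedGE_ofFn

/-- Semistandard tableaux of shape `λ` with entries in the `n` letters `0, …, n - 1` (the condition
on cells outside the diagram, where Mathlib's tableaux are `0`, is void for `0 < n`). -/
def Tableau {n : ℕ} (l : Partn n) : Type :=
  {T : SemistandardYoungTableau l.diagram // ∀ i j, T i j < n}

/-- The reading word of a tableau: rows from top to bottom, each row from right to left. -/
def reading {n : ℕ} {l : Partn n} (T : Tableau l) : List (Fin n) :=
  (List.finRange n).flatMap fun i =>
    (List.range (l.1 i)).reverse.map fun j => ⟨T.1 i j, T.2 i j⟩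

/-- The crystal `B(λ)` of the irreducible highest weight module of highest weight `λ`, for a
partition `λ`, as the set of semistandard tableaux of shape `λ` with entries in `n` letters: the
Kashiwara operators act through the reading word. -/
noncomputable def tableauCrystal {n : ℕ} (l : Partn n) : CrystalData n (Tableau l) :=
  (wordCrystal n).comap reading

/-! ### Crystal structures on matrices -/

/-- `n × n` matrices with non-negative integral entries. -/
abbrev Mat (n : ℕ) : Type := Matrix (Fin n) (Fin n) ℕ

section Matrices

variable {n : ℕ}

/-- The matrix `M(a, b)` of the list of pairs `(a_k, b_k)`. -/
def ofBiword (L : List (Fin n × Fin n)) : Mat n := fun i j => L.count (i, j)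

/-- The biword of `M`: the list containing `(i, j)` exactly `m_ij` times, sorted by increasing `j`,
and for equal `j` by decreasing `i`. -/
def biword (M : Mat n) : List (Fin n × Fin n) :=
  (List.finRange n).flatMap fun j =>
    (List.finRange n).reverse.flatMap fun i => List.replicate (M i j) (i, j)

/-- The word `a` of `M = M(a, b)`. -/
def wordA (M : Mat n) : List (Fin n) := (biword M).map Prod.fst

/-- The word `b` of `M = M(a, b)`. -/
def wordB (M : Mat n) : List (Fin n) := (biword M).map Prod.snd

theorem ofBiword_biword (M : Mat n) : ofBiword (biword M) = M := by
  ext i j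
  have h1 : ∀ y x : Fin n, List.count (i, j) (List.replicate (M x y) (x, y)) =
      if x = i then (if y = j then M i j else 0) else 0 := by
    intro y x
    rw [List.count_replicate]
    by_cases hx : x = i <;> by_cases hy : y = j <;> simp [hx, hy]
  simp only [ofBiword, biword, List.count_flatMap, Function.comp_def, List.map_reverse,
    List.sum_reverse, h1, ← List.ofFn_eq_map, List.sum_ofFn]
  simp

theorem biword_sorted (M : Mat n) :
    (biword M).Pairwise fun p q => p.2 < q.2 ∨ (p.2 = q.2 ∧ q.1 ≤ p.1) := by
  have hs : (List.finRange n).Pairwise (· < ·) := List.pairwise_lt_finRange n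
  unfold biword
  rw [List.pairwise_flatMap]
  refine ⟨fun j _ => ?_, hs.imp ?_⟩
  · rw [List.pairwise_flatMap]
    refine ⟨fun i _ => ?_, (List.pairwise_reverse.2 hs).imp ?_⟩
    · exact List.pairwise_replicate.2 (Or.inr (Or.inr ⟨rfl, le_rfl⟩))
    · intro a b hab x hx y hy
      rw [List.eq_of_mem_replicate hx, List.eq_of_mem_replicate hy]
      exact Or.inr ⟨rfl, hab.le⟩
  · intro a b hab x hx y hy
    obtain ⟨c, -, hx⟩ := List.mem_flatMap.1 hx
    obtain ⟨d, -, hy⟩ := List.mem_flatMap.1 hy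
    rw [List.eq_of_mem_replicate hx, List.eq_of_mem_replicate hy]
    exact Or.inl hab

/-- The crystal structure of the row operators: `x i M(a, b) = M(x i a, b)` for `x = e, f`. -/
def rowCrystal (n : ℕ) : CrystalData n (Mat n) where
  wt M := wordWt (wordA M)
  eps i M := wordEps i (wordA M)
  phi i M := wordPhi i (wordA M)
  e i M := (wordE i (wordA M)).map fun a => ofBiword (a.zip (wordB M))
  f i M := (wordF i (wordA M)).map fun a => ofBiword (a.zip (wordB M))

/-- The crystal structure of the column operators, `x i` (column) `M = (x i Mᵀ)ᵀ`. -/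
def colCrystal (n : ℕ) : CrystalData n (Mat n) where
  wt M := (rowCrystal n).wt M.transpose
  eps i M := (rowCrystal n).eps i M.transpose
  phi i M := (rowCrystal n).phi i M.transpose
  e i M := ((rowCrystal n).e i M.transpose).map Matrix.transpose
  f i M := ((rowCrystal n).f i M.transpose).map Matrix.transpose

/-- The diagonal `gl n`-crystal structure on matrices: the tensor product rule, applied to the row
structure as the first and the column structure as the second tensor factor. On a bicrystal
component `B(λ) × B(λ)`, where these act on the two factors, this is `B(λ) ⊗ B(λ)`. -/
def diagCrystal (n : ℕ) : CrystalData n (Mat n) where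
  wt M := (rowCrystal n).wt M + (colCrystal n).wt M
  eps i M := max ((rowCrystal n).eps i M)
    ((colCrystal n).eps i M - pairing ((rowCrystal n).wt M) i)
  phi i M := max ((rowCrystal n).phi i M + pairing ((colCrystal n).wt M) i)
    ((colCrystal n).phi i M)
  e i M := if (colCrystal n).eps i M ≤ (rowCrystal n).phi i M then (rowCrystal n).e i M
    else (colCrystal n).e i M
  f i M := if (colCrystal n).eps i M < (rowCrystal n).phi i M then (rowCrystal n).f i M
    else (colCrystal n).f i M

/-- Lower triangular matrices. -/
def lowerMat (n : ℕ) : Set (Mat n) := {M | ∀ i j, i < j → M i j = 0}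

/-- The connected component of `diag(λ₁, …, λ_n)` for the diagonal crystal structure. -/
def diagComponent (l : Partn n) : Set (Mat n) :=
  (diagCrystal n).component (Matrix.diagonal l.1)

end Matrices

end DiagCrystal

/-! The engine is the commutation of row and column operators. For rows `i`, `i + 1` of an array,
`ε` is the maximum of the function `height i`, and `e i` moves a unit from row `i + 1` up to row `i`
in the column where this maximum is first attained. A column move alters the heights of two adjacent
rows in at most one place and keeps their maximum. Hence row and column operators commute
(`RowStep.diamond`) and column operators preserve row `ε` (`ColStep.height_le_iff`).

Tableaux of shape `μ` are the arrays with column sums `μ` on which all column raising operators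
vanish: column `j` of the array records the content of row `j` of the tableau, and being
column-highest is column strictness. Row operators preserve this class, and its only row-highest
member is the diagonal array of `μ`.

For a matrix `M` consider the block array `[M | Mᵗ]`. Its reading word is the tensor product of the
row word and the column word of `M`, so the row operator acts on it by the tensor product rule,
changing one block. A column operator inside the other block then turns the result into `[M' |
M'ᵗ]`, where `M'` is the diagonal image of `M` (`diagE_rowStep`). Raising the columns of `[M | Mᵗ]`
to a column-highest array therefore relates `M` to a tableau (`Corr`), compatibly with weight, `ε`
and `e i`.

Lower triangularity survives because the tensor product rule rules out exactly the moves that would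
create an entry `(i, i + 1)`. A lower triangular highest weight matrix is row-highest, hence also
upper triangular, hence `diag(λ)`. Its weight is `2λ`, which forces the related tableau to have
shape `2λ`. Components are thus separated by `λ`, and since both crystals have a unique highest
weight element, the relation is the graph of an isomorphism (`nonempty_iso`). -/

namespace DiagCrystal

/-! ### The bracketing rule for the operators on words. -/

section Words

variable {n : ℕ}

theorem lo_ne_hi (i : Fin (n - 1)) : lo i ≠ hi i := by
  simp [lo, hi, Fin.ext_iff]

theorem pairing_add (μ ν : Fin n → ℤ) (i : Fin (n - 1)) :
    pairing (μ + ν) i = pairing μ i + pairing ν i := by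
  simp only [pairing, Pi.add_apply]; ring

theorem pairing_root (i : Fin (n - 1)) : pairing (root i) i = 2 := by
  have := lo_ne_hi i
  simp [pairing, root, this, this.symm]

theorem letter_hi (i : Fin (n - 1)) : (letterCrystal n).eps i (hi i) = 1 ∧
    (letterCrystal n).phi i (hi i) = 0 ∧ pairing ((letterCrystal n).wt (hi i)) i = -1 := by
  have h := lo_ne_hi i
  simp [letterCrystal, pairing, h, h.symm]

theorem letter_lo (i : Fin (n - 1)) : (letterCrystal n).eps i (lo i) = 0 ∧
    (letterCrystal n).phi i (lo i) = 1 ∧ pairing ((letterCrystal n).wt (lo i)) i = 1 := by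
  have h := lo_ne_hi i
  simp [letterCrystal, pairing, h, h.symm]

theorem letter_other {i : Fin (n - 1)} {a : Fin n} (h₁ : a ≠ hi i) (h₂ : a ≠ lo i) :
    (letterCrystal n).eps i a = 0 ∧
    (letterCrystal n).phi i a = 0 ∧ pairing ((letterCrystal n).wt a) i = 0 := by
  simp [letterCrystal, pairing, h₁, h₂, h₁.symm, h₂.symm]

theorem letter_cases (i : Fin (n - 1)) (a : Fin n) :
    (a = hi i ∧ (letterCrystal n).eps i a = 1 ∧
      (letterCrystal n).phi i a = 0 ∧ pairing ((letterCrystal n).wt a) i = -1) ∨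
    (a = lo i ∧ (letterCrystal n).eps i a = 0 ∧
      (letterCrystal n).phi i a = 1 ∧ pairing ((letterCrystal n).wt a) i = 1) ∨
    ((a ≠ hi i ∧ a ≠ lo i) ∧ (letterCrystal n).eps i a = 0 ∧
      (letterCrystal n).phi i a = 0 ∧ pairing ((letterCrystal n).wt a) i = 0) := by
  by_cases h₁ : a = hi i
  · subst h₁; exact Or.inl ⟨rfl, letter_hi i⟩
  · by_cases h₂ : a = lo i
    · subst h₂; exact Or.inr (Or.inl ⟨rfl, letter_lo i⟩)
    · exact Or.inr (Or.inr ⟨⟨h₁, h₂⟩, letter_other h₁ h₂⟩)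

theorem wordWt_append (u v : List (Fin n)) : wordWt (u ++ v) = wordWt u + wordWt v := by
  induction u with
  | nil => simp [wordWt]
  | cons a u ih => simp [wordWt, ih, add_assoc]

theorem pairing_cons (i : Fin (n - 1)) (a : Fin n) (w : List (Fin n)) :
    pairing (wordWt (a :: w)) i = pairing ((letterCrystal n).wt a) i + pairing (wordWt w) i :=
  pairing_add _ _ _

theorem wordWt_apply (w : List (Fin n)) (a : Fin n) : wordWt w a = w.count a := by
  induction w with
  | nil => simp [wordWt]
  | cons b w ih =>
    rw [List.count_cons]
    by_cases h : b = a
    · subst h; simp [wordWt, letterCrystal, ih, add_comm]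
    · simp [wordWt, letterCrystal, ih, Ne.symm h, h]

theorem wordEps_nonneg (i : Fin (n - 1)) (w : List (Fin n)) : 0 ≤ wordEps i w := by
  cases w with
  | nil => simp [wordEps]
  | cons a w =>
    rw [wordEps]
    rcases letter_cases i a with h | h | h <;> omega

theorem wordPhi_eq (i : Fin (n - 1)) (w : List (Fin n)) :
    wordPhi i w = pairing (wordWt w) i + wordEps i w := by
  induction w with
  | nil => simp [wordPhi, wordEps, wordWt, pairing]
  | cons a w ih =>
    rw [wordPhi, wordEps, pairing_cons, ih]
    rcases letter_cases i a with h | h | h <;> omega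

theorem wordPhi_nonneg (i : Fin (n - 1)) (w : List (Fin n)) : 0 ≤ wordPhi i w := by
  induction w with
  | nil => simp [wordPhi]
  | cons a w ih => rw [wordPhi]; omega

/-- Associativity of the tensor product rule at the level of `ε`. -/
theorem wordEps_append (i : Fin (n - 1)) (u v : List (Fin n)) :
    wordEps i (u ++ v) = max (wordEps i u) (wordEps i v - pairing (wordWt u) i) := by
  induction u with
  | nil => have := wordEps_nonneg i v; simp [wordEps, wordWt, pairing, this]
  | cons a u ih =>
    rw [List.cons_append, wordEps, wordEps, pairing_cons, ih]
    omega

theorem wordEps_append_hi {i : Fin (n - 1)} {u v : List (Fin n)} (hu : wordPhi i u = 0)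
    (hv : wordEps i v = 0) : wordEps i (u ++ hi i :: v) = 1 - pairing (wordWt u) i := by
  rw [wordEps_append, wordEps, hv]
  rw [wordPhi_eq] at hu
  have := letter_hi i
  omega

theorem wordEps_append_lo {i : Fin (n - 1)} {u v : List (Fin n)} (hu : wordPhi i u = 0)
    (hv : wordEps i v = 0) : wordEps i (u ++ lo i :: v) = - pairing (wordWt u) i := by
  rw [wordEps_append, wordEps, hv]
  rw [wordPhi_eq] at hu
  have := letter_lo i
  omega

/-- Cancel each letter `i` against a later letter `i + 1`. The hypotheses say that no `i` of `u` and
no `i + 1` of `v` survives, so the displayed letter is the rightmost surviving `i + 1`, on which `e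
i` acts. -/
theorem wordE_append_hi {i : Fin (n - 1)} {u v : List (Fin n)} (hu : wordPhi i u = 0)
    (hv : wordEps i v = 0) : wordE i (u ++ hi i :: v) = some (u ++ lo i :: v) := by
  induction u with
  | nil =>
    have := letter_hi i
    simp [wordE, hv, this.2.1]
    simp [letterCrystal]
  | cons a u ih =>
    rw [wordPhi] at hu
    have h0 := wordPhi_nonneg i u
    have hu' : wordPhi i u = 0 := by omega
    have h1 := wordEps_append_hi hu' hv
    rw [List.cons_append, wordE, if_neg (by omega), ih hu']
    rfl

theorem wordF_append_lo {i : Fin (n - 1)} {u v : List (Fin n)} (hu : wordPhi i u = 0)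
    (hv : wordEps i v = 0) : wordF i (u ++ lo i :: v) = some (u ++ hi i :: v) := by
  induction u with
  | nil =>
    have := letter_lo i
    simp [wordF, hv, this.2.1]
    simp [letterCrystal]
  | cons a u ih =>
    rw [wordPhi] at hu
    have h0 := wordPhi_nonneg i u
    have hu' : wordPhi i u = 0 := by omega
    have h1 := wordEps_append_lo hu' hv
    rw [List.cons_append, wordF, if_neg (by omega), ih hu']
    rfl

theorem exists_hi_of_wordEps_pos {i : Fin (n - 1)} {w : List (Fin n)} (h : 0 < wordEps i w) :
    ∃ u v, w = u ++ hi i :: v ∧ wordPhi i u = 0 ∧ wordEps i v = 0 := by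
  induction w with
  | nil => simp [wordEps] at h
  | cons a w ih =>
    have h0 := wordEps_nonneg i w
    rw [wordEps] at h
    have hc := letter_cases i a
    -- In this case `ε` of `a :: w` equals `ε` of the letter `a`; being positive, it forces `a = hi
    -- i`.
    by_cases hw : wordEps i w ≤ (letterCrystal n).phi i a
    · have ha : a = hi i := by
        rcases hc with hc | hc | hc
        · exact hc.1
        · omega
        · omega
      subst ha
      have := letter_hi i
      exact ⟨[], w, rfl, rfl, by omega⟩
    · obtain ⟨u, v, rfl, hu, hv⟩ := ih (by omega)
      have h1 := wordEps_append_hi hu hv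
      refine ⟨a :: u, v, rfl, ?_, hv⟩
      rw [wordPhi, hu]
      omega

theorem exists_lo_of_wordPhi_pos {i : Fin (n - 1)} {w : List (Fin n)} (h : 0 < wordPhi i w) :
    ∃ u v, w = u ++ lo i :: v ∧ wordPhi i u = 0 ∧ wordEps i v = 0 := by
  induction w with
  | nil => simp [wordPhi] at h
  | cons a w ih =>
    have h0 := wordEps_nonneg i w
    have h2 := wordPhi_eq i w
    rw [wordPhi] at h
    have hc := letter_cases i a
    by_cases hw : wordEps i w < (letterCrystal n).phi i a
    · have ha : a = lo i := by
        rcases hc with hc | hc | hc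
        · omega
        · exact hc.1
        · omega
      subst ha
      have := letter_lo i
      exact ⟨[], w, rfl, rfl, by omega⟩
    · obtain ⟨u, v, rfl, hu, hv⟩ := ih (by omega)
      have h1 := wordEps_append_lo hu hv
      refine ⟨a :: u, v, rfl, ?_, hv⟩
      rw [wordPhi, hu]
      omega

theorem wordE_eq_none {i : Fin (n - 1)} {w : List (Fin n)} (h : wordEps i w = 0) :
    wordE i w = none := by
  induction w with
  | nil => rfl
  | cons a w ih =>
    have h0 := wordEps_nonneg i w
    rw [wordEps] at h
    rw [wordE]
    split_ifs with hw
    · have ha : a ≠ hi i := by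
        rintro rfl
        have := letter_hi i
        omega
      simp [letterCrystal, ha]
    · rw [ih]
      · rfl
      · have hc := letter_cases i a
        omega

theorem wordF_eq_none {i : Fin (n - 1)} {w : List (Fin n)} (h : wordPhi i w = 0) :
    wordF i w = none := by
  induction w with
  | nil => rfl
  | cons a w ih =>
    have h0 := wordPhi_nonneg i w
    have h2 := wordPhi_eq i w
    rw [wordPhi] at h
    rw [wordF]
    split_ifs with hw
    · have ha : a ≠ lo i := by
        rintro rfl
        have := letter_lo i
        omega
      simp [letterCrystal, ha]
    · rw [ih (by omega)]
      rfl

theorem wordE_eq_some_iff {i : Fin (n - 1)} {w w' : List (Fin n)} :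
    wordE i w = some w' ↔ ∃ u v, w = u ++ hi i :: v ∧ w' = u ++ lo i :: v ∧
      wordPhi i u = 0 ∧ wordEps i v = 0 := by
  constructor
  · intro h
    have hp : 0 < wordEps i w := by
      refine lt_of_le_of_ne (wordEps_nonneg i w) fun h0 => ?_
      rw [wordE_eq_none h0.symm] at h
      cases h
    obtain ⟨u, v, rfl, hu, hv⟩ := exists_hi_of_wordEps_pos hp
    rw [wordE_append_hi hu hv, Option.some_inj] at h
    exact ⟨u, v, rfl, h.symm, hu, hv⟩
  · rintro ⟨u, v, rfl, rfl, hu, hv⟩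
    exact wordE_append_hi hu hv

theorem wordF_eq_some_iff {i : Fin (n - 1)} {w w' : List (Fin n)} :
    wordF i w = some w' ↔ ∃ u v, w = u ++ lo i :: v ∧ w' = u ++ hi i :: v ∧
      wordPhi i u = 0 ∧ wordEps i v = 0 := by
  constructor
  · intro h
    have hp : 0 < wordPhi i w := by
      refine lt_of_le_of_ne (wordPhi_nonneg i w) fun h0 => ?_
      rw [wordF_eq_none h0.symm] at h
      cases h
    obtain ⟨u, v, rfl, hu, hv⟩ := exists_lo_of_wordPhi_pos hp
    rw [wordF_append_lo hu hv, Option.some_inj] at h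
    exact ⟨u, v, rfl, h.symm, hu, hv⟩
  · rintro ⟨u, v, rfl, rfl, hu, hv⟩
    exact wordF_append_lo hu hv

/-- The conditions on `u` and `v` do not involve the letter between them, so both operators use the
same factorization. -/
theorem wordF_iff_wordE {i : Fin (n - 1)} {w w' : List (Fin n)} :
    wordF i w = some w' ↔ wordE i w' = some w := by
  rw [wordF_eq_some_iff, wordE_eq_some_iff]
  constructor <;> rintro ⟨u, v, h₁, h₂, h₃⟩ <;> exact ⟨u, v, h₂, h₁, h₃⟩

theorem exists_wordE {i : Fin (n - 1)} {w : List (Fin n)} (h : 0 < wordEps i w) :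
    ∃ w', wordE i w = some w' := by
  obtain ⟨u, v, rfl, hu, hv⟩ := exists_hi_of_wordEps_pos h
  exact ⟨_, wordE_append_hi hu hv⟩

theorem exists_wordF {i : Fin (n - 1)} {w : List (Fin n)} (h : 0 < wordPhi i w) :
    ∃ w', wordF i w = some w' := by
  obtain ⟨u, v, rfl, hu, hv⟩ := exists_lo_of_wordPhi_pos h
  exact ⟨_, wordF_append_lo hu hv⟩

theorem wordE_spec {i : Fin (n - 1)} {w w' : List (Fin n)} (h : wordE i w = some w') :
    wordEps i w' = wordEps i w - 1 ∧ wordPhi i w' = wordPhi i w + 1 ∧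
      wordWt w' = wordWt w + root i := by
  obtain ⟨u, v, rfl, rfl, hu, hv⟩ := wordE_eq_some_iff.1 h
  have h₁ := wordEps_append_hi hu hv
  have h₂ := wordEps_append_lo hu hv
  have hw : wordWt (u ++ lo i :: v) = wordWt (u ++ hi i :: v) + root i := by
    simp only [wordWt_append, wordWt, letterCrystal, root]
    abel
  refine ⟨by omega, ?_, hw⟩
  rw [wordPhi_eq, wordPhi_eq, hw, pairing_add, pairing_root]
  omega

theorem wordCrystal_isCrystal : (wordCrystal n).IsCrystal where
  phi_eq i b := wordPhi_eq i b
  e_some _ _ _ h := wordE_spec h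
  f_some i b b' h := by
    obtain ⟨h₁, h₂, h₃⟩ := wordE_spec (wordF_iff_wordE.1 h)
    refine ⟨?_, ?_, ?_⟩
    · change wordEps i b' = wordEps i b + 1
      omega
    · change wordPhi i b' = wordPhi i b - 1
      omega
    · change wordWt b' = wordWt b - root i
      rw [h₃]; abel
  f_iff_e _ _ _ := wordF_iff_wordE

end Words

/-! ### Row and column operators on integer arrays, and their commutation. -/

section Arrays

/-- Arrays of integers, indexed by rows and columns. -/
abbrev Arr : Type := ℕ → ℕ → ℤ

/-- The elementary array with entry `1` in row `a` and column `b`. -/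
def unitArr (a b : ℕ) : Arr := fun i j => if i = a ∧ j = b then 1 else 0

/-- The transposed array. -/
def tr (X : Arr) : Arr := fun i j => X j i

/-- The excess of the letters `i + 1` over the letters `i` in the reading word of `X`, up to the
last letter `i + 1` of column `k`. -/
def height (i : ℕ) (X : Arr) (k : ℕ) : ℤ :=
  ∑ j ∈ Finset.range (k + 1), X (i + 1) j - ∑ j ∈ Finset.range k, X i j

/-- `h` attains its maximum at `k` for the first time. -/
def FirstMax (h : ℕ → ℤ) (k : ℕ) : Prop := (∀ l < k, h l < h k) ∧ ∀ l, h l ≤ h k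

/-- `Y` is obtained from `X` by the row operator `e i`. -/
def RowStep (i : ℕ) (X Y : Arr) : Prop :=
  ∃ k, FirstMax (height i X) k ∧ 0 < height i X k ∧ Y = X - unitArr (i + 1) k + unitArr i k

/-- `Y` is obtained from `X` by the column operator `e j`. -/
def ColStep (j : ℕ) (X Y : Arr) : Prop := RowStep j (tr X) (tr Y)

/-- Arrays with non-negative entries, supported in the first `n` rows and `m` columns. -/
structure Good (n m : ℕ) (X : Arr) : Prop where
  nonneg : ∀ i j, 0 ≤ X i j
  row_zero : ∀ i j, n ≤ i → X i j = 0
  col_zero : ∀ i j, m ≤ j → X i j = 0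

theorem tr_tr (X : Arr) : tr (tr X) = X := rfl

theorem Good.tr {n m : ℕ} {X : Arr} (h : Good n m X) : Good m n (tr X) :=
  ⟨fun i j => h.nonneg j i, fun i j => h.col_zero j i, fun i j => h.row_zero j i⟩

theorem height_zero (i : ℕ) (X : Arr) : height i X 0 = X (i + 1) 0 := by
  simp [height]

theorem height_succ (i : ℕ) (X : Arr) (k : ℕ) :
    height i X (k + 1) = height i X k + X (i + 1) (k + 1) - X i k := by
  simp only [height, Finset.sum_range_succ]; ring

theorem height_add (i : ℕ) (X Y : Arr) (k : ℕ) :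
    height i (X + Y) k = height i X k + height i Y k := by
  simp only [height, Pi.add_apply, Finset.sum_add_distrib]; ring

theorem height_sub (i : ℕ) (X Y : Arr) (k : ℕ) :
    height i (X - Y) k = height i X k - height i Y k := by
  simp only [height, Pi.sub_apply, Finset.sum_sub_distrib]; ring

theorem height_unitArr (i a b l : ℕ) : height i (unitArr a b) l =
    (if a = i + 1 ∧ b ≤ l then 1 else 0) - if a = i ∧ b < l then 1 else 0 := by
  have h : ∀ c q : ℕ, ∑ j ∈ Finset.range q, unitArr a b c j = if a = c ∧ b < q then 1 else 0 := by
    intro c q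
    by_cases hc : c = a
    · subst hc; simp [unitArr]
    · simp [unitArr, hc, Ne.symm hc]
  simp only [height, h, Nat.lt_succ_iff]

theorem tr_move (X : Arr) (a b c d : ℕ) :
    tr (X - unitArr a b + unitArr c d) = tr X - unitArr b a + unitArr d c := by
  funext i j
  simp [tr, unitArr, and_comm]

theorem FirstMax.unique {h : ℕ → ℤ} {k l : ℕ} (hk : FirstMax h k) (hl : FirstMax h l) :
    k = l := by
  rcases lt_trichotomy k l with hkl | hkl | hkl
  · exact absurd (hl.1 _ hkl) (hk.2 l).not_gt
  · exact hkl
  · exact absurd (hk.1 _ hkl) (hl.2 k).not_gt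

theorem colStep_iff {j : ℕ} {X Y : Arr} : ColStep j X Y ↔ ∃ l, FirstMax (height j (tr X)) l ∧
    0 < height j (tr X) l ∧ Y = X - unitArr l (j + 1) + unitArr l j := by
  refine exists_congr fun l => and_congr_right fun _ => and_congr_right fun _ => ?_
  constructor
  · intro h
    have := congrArg tr h
    rwa [tr_move, tr_tr, tr_tr] at this
  · rintro rfl
    rw [tr_move]

theorem RowStep.height_eq {i : ℕ} {X Y : Arr} {k : ℕ}
    (hY : Y = X - unitArr (i + 1) k + unitArr i k) (l : ℕ) :
    height i Y l = height i X l - (if k ≤ l then 1 else 0) - if k < l then 1 else 0 := by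
  subst hY
  rw [height_add, height_sub, height_unitArr, height_unitArr]
  simp only [true_and, Nat.succ_ne_self, Nat.left_eq_add, one_ne_zero, false_and, if_false]
  ring

theorem RowStep.unique {i : ℕ} {X Y Y' : Arr} (h : RowStep i X Y) (h' : RowStep i X Y') :
    Y = Y' := by
  obtain ⟨k, hk, -, rfl⟩ := h
  obtain ⟨l, hl, -, rfl⟩ := h'
  rw [hk.unique hl]

/-- The height can rise at column `k` only if that column contains a letter `i + 1`; this keeps
entries non-negative under a row step. -/
theorem FirstMax.entry_pos {i : ℕ} {X : Arr} {k n m : ℕ} (hX : Good n m X)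
    (h : FirstMax (height i X) k) (hp : 0 < height i X k) : 0 < X (i + 1) k := by
  cases k with
  | zero => rwa [height_zero] at hp
  | succ k =>
    have h1 := h.1 k (Nat.lt_succ_self k)
    rw [height_succ] at h1
    have := hX.nonneg i k
    linarith

theorem RowStep.good {i n m : ℕ} {X Y : Arr} (hi : i + 1 < n) (hX : Good n m X)
    (h : RowStep i X Y) : Good n m Y := by
  obtain ⟨k, hk, hp, rfl⟩ := h
  have hpos := hk.entry_pos hX hp
  have hkm : k < m := by
    by_contra hkm
    rw [hX.col_zero _ _ (not_lt.1 hkm)] at hpos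
    exact lt_irrefl _ hpos
  refine ⟨fun a b => ?_, fun a b ha => ?_, fun a b hb => ?_⟩
  · have h0 := hX.nonneg a b
    simp only [Pi.add_apply, Pi.sub_apply, unitArr]
    split_ifs with h1 h2 h2
    · omega
    · obtain ⟨rfl, rfl⟩ := h1; omega
    · omega
    · omega
  · simp only [Pi.add_apply, Pi.sub_apply, unitArr, hX.row_zero a b ha]
    rw [if_neg (by omega), if_neg (by omega)]; rfl
  · simp only [Pi.add_apply, Pi.sub_apply, unitArr, hX.col_zero a b hb]
    rw [if_neg (by omega), if_neg (by omega)]; rfl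

theorem ColStep.good {j n m : ℕ} {X Y : Arr} (hj : j + 1 < m) (hX : Good n m X)
    (h : ColStep j X Y) : Good n m Y :=
  (RowStep.good hj hX.tr h).tr

theorem height_stable {i n m : ℕ} {X : Arr} (hX : Good n m X) {l : ℕ} (hl : m ≤ l) :
    height i X l = height i X m := by
  induction l, hl using Nat.le_induction with
  | base => rfl
  | succ l hl ih =>
    rw [height_succ, ih, hX.col_zero _ _ hl, hX.col_zero _ _ (Nat.le_succ_of_le hl)]
    ring

theorem exists_height_max {i n m : ℕ} {X : Arr} (hX : Good n m X) :
    ∃ k, ∀ l, height i X l ≤ height i X k := by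
  obtain ⟨k, -, hk⟩ := Finset.exists_max_image (Finset.range (m + 1)) (height i X) ⟨0, by simp⟩
  refine ⟨k, fun l => ?_⟩
  rcases le_total l m with hl | hl
  · exact hk l (by simp; omega)
  · rw [height_stable hX hl]
    exact hk m (by simp)

theorem exists_rowStep {i n m : ℕ} {X : Arr} (hX : Good n m X) (h : ∃ k, 0 < height i X k) :
    ∃ Y, RowStep i X Y := by
  classical
  have hm := exists_height_max (i := i) hX
  have hk := Nat.find_spec hm
  refine ⟨_, Nat.find hm, ⟨fun l hl => ?_, hk⟩, ?_, rfl⟩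
  · have := Nat.find_min hm hl
    push Not at this
    obtain ⟨q, hq⟩ := this
    exact hq.trans_le (hk q)
  · obtain ⟨q, hq⟩ := h
    exact hq.trans_le (hk q)

theorem exists_colStep {j n m : ℕ} {X : Arr} (hX : Good n m X)
    (h : ∃ k, 0 < height j (tr X) k) : ∃ Y, ColStep j X Y := by
  obtain ⟨Y, hY⟩ := exists_rowStep hX.tr h
  exact ⟨tr Y, hY⟩

/-- This is `f i`, which acts at the last maximum of the height. The value at `m` is the final
constant value, so the hypothesis expresses `φ > 0` and ensures that a last maximum exists. -/
theorem exists_rowStep_to {i n m : ℕ} {Y : Arr} (hi : i + 1 < n) (hY : Good n m Y)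
    (h : ∃ k, height i Y m < height i Y k) : ∃ X, Good n m X ∧ RowStep i X Y := by
  classical
  obtain ⟨k₀, hk₀⟩ := exists_height_max (i := i) hY
  have hm : ¬ ∀ l, height i Y l ≤ height i Y m := by
    obtain ⟨q, hq⟩ := h
    exact fun hl => (hl q).not_gt hq
  have hk₀m : k₀ ≤ m := by
    by_contra hlt
    rw [height_stable hY (by omega : m ≤ k₀)] at hk₀
    exact hm hk₀
  set P : ℕ → Prop := fun k => ∀ l, height i Y l ≤ height i Y k with hP
  have hk : P (Nat.findGreatest P m) := Nat.findGreatest_spec (P := P) hk₀m hk₀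
  have hgt : ∀ l, Nat.findGreatest P m < l → height i Y l < height i Y (Nat.findGreatest P m) := by
    intro l hl
    rcases le_total l m with hlm | hlm
    · have := Nat.findGreatest_is_greatest hl hlm
      simp only [hP] at this
      push Not at this
      obtain ⟨q, hq⟩ := this
      exact hq.trans_le (hk q)
    · rw [height_stable hY hlm]
      push Not at hm
      obtain ⟨q, hq⟩ := hm
      exact hq.trans_le (hk q)
  generalize Nat.findGreatest P m = k at hk hgt
  have hpos : 0 < Y i k := by
    have h1 := hgt (k + 1) (Nat.lt_succ_self k)
    rw [height_succ] at h1
    have := hY.nonneg (i + 1) (k + 1)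
    linarith
  have hkm : k < m := by
    by_contra hkm
    rw [hY.col_zero _ _ (not_lt.1 hkm)] at hpos
    exact lt_irrefl _ hpos
  have hYX : Y = (Y + unitArr (i + 1) k - unitArr i k) - unitArr (i + 1) k + unitArr i k := by
    abel
  refine ⟨Y + unitArr (i + 1) k - unitArr i k, ⟨fun a b => ?_, fun a b ha => ?_, fun a b hb => ?_⟩,
    k, ⟨fun l hl => ?_, fun l => ?_⟩, ?_, hYX⟩
  · have h0 := hY.nonneg a b
    simp only [Pi.add_apply, Pi.sub_apply, unitArr]
    split_ifs with h1 h2 h2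
    · omega
    · omega
    · obtain ⟨rfl, rfl⟩ := h2; omega
    · omega
  · simp only [Pi.add_apply, Pi.sub_apply, unitArr, hY.row_zero a b ha]
    rw [if_neg (by omega), if_neg (by omega)]; rfl
  · simp only [Pi.add_apply, Pi.sub_apply, unitArr, hY.col_zero a b hb]
    rw [if_neg (by omega), if_neg (by omega)]; rfl
  · have h1 := RowStep.height_eq hYX l
    have h2 := RowStep.height_eq hYX k
    have h3 := hk l
    rw [if_neg (by omega), if_neg (by omega)] at h1
    rw [if_pos le_rfl, if_neg (lt_irrefl k)] at h2
    omega
  · have h1 := RowStep.height_eq hYX l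
    have h2 := RowStep.height_eq hYX k
    have h3 := hk l
    rw [if_pos le_rfl, if_neg (lt_irrefl k)] at h2
    by_cases hkl : k < l
    · have h4 := hgt l hkl
      rw [if_pos hkl.le, if_pos hkl] at h1
      omega
    · rw [if_neg hkl] at h1
      split_ifs at h1 <;> omega
  · have h2 := RowStep.height_eq hYX k
    have h3 := hk 0
    have h4 := hY.nonneg (i + 1) 0
    rw [height_zero] at h3
    rw [if_pos le_rfl, if_neg (lt_irrefl k)] at h2
    omega

/-- A position not exceeding its predecessor is never the first maximum, so lowering it is harmless.
-/
theorem FirstMax.sub_at {h h' : ℕ → ℤ} {j k : ℕ} (hk : FirstMax h k) (hj : h (j + 1) ≤ h j)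
    (hh : ∀ p, h' p = h p - if p = j + 1 then 1 else 0) : FirstMax h' k ∧ h' k = h k := by
  have hne : k ≠ j + 1 := by
    rintro rfl
    exact (hk.1 j (Nat.lt_succ_self j)).not_ge hj
  have h0 := hh k
  rw [if_neg hne] at h0
  refine ⟨⟨fun l hl => ?_, fun l => ?_⟩, by omega⟩
  · have h1 := hh l
    have h2 := hk.1 l hl
    split_ifs at h1 <;> omega
  · have h1 := hh l
    have h2 := hk.2 l
    split_ifs at h1 <;> omega

/-- Raising `h j` below `h (j + 1)` by one cannot exceed the maximum; it could create an earlier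
maximum only when `k = j + 1` and the gap is one, which `hc` excludes. That case is
`FirstMax.add_shift`. -/
theorem FirstMax.add_at {h h' : ℕ → ℤ} {j k : ℕ} (hk : FirstMax h k) (hj : h j < h (j + 1))
    (hh : ∀ p, h' p = h p + if p = j then 1 else 0) (hc : k = j + 1 → h j + 1 < h (j + 1)) :
    FirstMax h' k ∧ h' k = h k := by
  have hne : k ≠ j := by
    rintro rfl
    exact (hk.2 (k + 1)).not_gt hj
  have h0 := hh k
  have h3 := hk.2 (j + 1)
  have h4 := hk.1 (j + 1)
  rw [if_neg hne] at h0
  refine ⟨⟨fun l hl => ?_, fun l => ?_⟩, by omega⟩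
  · have h1 := hh l
    have h2 := hk.1 l hl
    split_ifs at h1 with hlj
    · subst hlj
      by_cases hkl : k = l + 1
      · subst hkl; omega
      · have := h4 (by omega)
        omega
    · omega
  · have h1 := hh l
    have h2 := hk.2 l
    split_ifs at h1 with hlj
    · subst hlj; omega
    · omega

theorem FirstMax.add_shift {h h' : ℕ → ℤ} {j : ℕ} (hk : FirstMax h (j + 1))
    (hj : h (j + 1) = h j + 1) (hh : ∀ p, h' p = h p + if p = j then 1 else 0) :
    FirstMax h' j ∧ h' j = h (j + 1) := by
  have h0 := hh j
  rw [if_pos rfl] at h0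
  refine ⟨⟨fun l hl => ?_, fun l => ?_⟩, by omega⟩
  · have h1 := hh l
    have h2 := hk.1 l (by omega)
    rw [if_neg (by omega)] at h1
    omega
  · have h1 := hh l
    have h2 := hk.2 l
    split_ifs at h1 with hlj
    · subst hlj; omega
    · omega

theorem height_colMove {i j l : ℕ} {X Z : Arr} (hZ : Z = X - unitArr l (j + 1) + unitArr l j)
    (p : ℕ) : height i Z p = height i X p + (if l = i + 1 ∧ p = j then 1 else 0)
      - if l = i ∧ p = j + 1 then 1 else 0 := by
  subst hZ
  rw [height_add, height_sub, height_unitArr, height_unitArr]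
  split_ifs <;> omega

/-- Both increments are `X (i + 1) (j + 1) - X i j`. This is the only link needed between row
heights and column heights. -/
theorem height_tr_sub (i j : ℕ) (X : Arr) : height i X (j + 1) - height i X j =
    height j (tr X) (i + 1) - height j (tr X) i := by
  rw [height_succ, height_succ, tr, tr]; ring

/-- The effect of a column operator on the heights of the rows. -/
theorem FirstMax.colMove {i j k l : ℕ} {X Z : Arr} (hk : FirstMax (height i X) k)
    (hl : FirstMax (height j (tr X)) l) (hZ : Z = X - unitArr l (j + 1) + unitArr l j) :
    (¬ (k = j + 1 ∧ l = i + 1 ∧ height i X (j + 1) = height i X j + 1) ∧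
      FirstMax (height i Z) k ∧ height i Z k = height i X k) ∨
    ((k = j + 1 ∧ l = i + 1 ∧ height i X (j + 1) = height i X j + 1) ∧
      FirstMax (height i Z) j ∧ height i Z j = height i X k) := by
  have hD := height_tr_sub i j X
  have hH := height_colMove (i := i) hZ
  -- The column move takes place in row `l`. If `l = i` it lowers the height at `j + 1`, if `l = i +
  -- 1` it raises the height at `j`, and otherwise the height is unchanged. That `l` is a first
  -- maximum for the columns supplies, through `hD`, the needed comparison of the heights at `j` and
  -- `j + 1`.
  by_cases hli : l = i
  · subst hli
    refine Or.inl ⟨by omega, hk.sub_at (j := j) ?_ fun p => ?_⟩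
    · have := hl.2 (l + 1)
      omega
    · rw [hH, if_neg (by omega)]
      simp
  · by_cases hli' : l = i + 1
    · subst hli'
      have hlt : height i X j < height i X (j + 1) := by
        have := hl.1 i (by omega)
        omega
      have hH' : ∀ p, height i Z p = height i X p + if p = j then 1 else 0 := by
        intro p
        rw [hH, if_neg (by omega : ¬ (i + 1 = i ∧ p = j + 1))]
        simp
      by_cases hc : k = j + 1 ∧ height i X (j + 1) = height i X j + 1
      · obtain ⟨rfl, hc⟩ := hc
        exact Or.inr ⟨⟨rfl, rfl, hc⟩, hk.add_shift hc hH'⟩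
      · exact Or.inl ⟨by tauto, hk.add_at hlt hH' (by omega)⟩
    · refine Or.inl ⟨by tauto, ?_⟩
      have : height i Z = height i X := by
        funext p
        rw [hH, if_neg (by tauto), if_neg (by tauto)]
        ring
      rw [this]
      exact ⟨hk, rfl⟩

/-- Row and column operators commute. -/
theorem RowStep.diamond {i j : ℕ} {X Y Z : Arr} (hY : RowStep i X Y) (hZ : ColStep j X Z) :
    ∃ W, RowStep i Z W ∧ ColStep j Y W := by
  obtain ⟨k, hk, hkp, hY⟩ := hY
  obtain ⟨l, hl, hlp, hZ⟩ := colStep_iff.1 hZ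
  have hD := height_tr_sub i j X
  have hY' : tr Y = tr X - unitArr k (i + 1) + unitArr k i := by rw [hY, tr_move]
  -- By `hD` the exceptional condition is symmetric under transposition, so it holds for both
  -- operators or for neither. In the exceptional case both start from the entry `(i + 1, j + 1)`,
  -- and both orders carry the unit to `(i, j)`, through opposite corners of the square.
  rcases hk.colMove hl hZ with ⟨hn, h1, h2⟩ | ⟨⟨rfl, rfl, hc⟩, h1, h2⟩
  · rcases hl.colMove hk hY' with ⟨-, h3, h4⟩ | ⟨⟨rfl, rfl, hc⟩, -⟩
    · refine ⟨_, ⟨k, h1, by omega, rfl⟩, colStep_iff.2 ⟨l, h3, by omega, ?_⟩⟩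
      rw [hY, hZ]; abel
    · exact absurd ⟨rfl, rfl, by omega⟩ hn
  · rcases hl.colMove hk hY' with ⟨hn, -⟩ | ⟨-, h3, h4⟩
    · exact absurd ⟨rfl, rfl, by omega⟩ hn
    · refine ⟨_, ⟨j, h1, by omega, rfl⟩, colStep_iff.2 ⟨i, h3, by omega, ?_⟩⟩
      rw [hY, hZ]; abel

/-- Column operators do not change `ε` of the rows. -/
theorem ColStep.height_le_iff {i j n m : ℕ} {X Z : Arr} (hX : Good n m X) (h : ColStep j X Z)
    (z : ℤ) : (∀ k, height i Z k ≤ z) ↔ ∀ k, height i X k ≤ z := by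
  obtain ⟨l, hl, -, hZ⟩ := colStep_iff.1 h
  obtain ⟨k, hk⟩ : ∃ k, FirstMax (height i X) k := by
    classical
    have hm := exists_height_max (i := i) hX
    refine ⟨Nat.find hm, fun q hq => ?_, Nat.find_spec hm⟩
    have := Nat.find_min hm hq
    push Not at this
    obtain ⟨r, hr⟩ := this
    exact hr.trans_le (Nat.find_spec hm r)
  rcases hk.colMove hl hZ with ⟨-, h1, h2⟩ | ⟨-, h1, h2⟩
  · exact ⟨fun h q => (hk.2 q).trans (h2 ▸ h k), fun h q => (h1.2 q).trans (h2 ▸ h k)⟩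
  · exact ⟨fun h q => (hk.2 q).trans (h2 ▸ h j), fun h q => (h1.2 q).trans (h2 ▸ h k)⟩

theorem RowStep.height_tr_le_iff {i j n m : ℕ} {X Y : Arr} (hX : Good n m X) (h : RowStep i X Y)
    (z : ℤ) : (∀ k, height j (tr Y) k ≤ z) ↔ ∀ k, height j (tr X) k ≤ z :=
  ColStep.height_le_iff hX.tr h z

theorem RowStep.colSum_eq {i n : ℕ} {X Y : Arr} (hi : i + 1 < n) (h : RowStep i X Y) (j : ℕ) :
    ∑ a ∈ Finset.range n, Y a j = ∑ a ∈ Finset.range n, X a j := by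
  obtain ⟨k, -, -, rfl⟩ := h
  have hs : ∀ a b : ℕ, a < n →
      ∑ q ∈ Finset.range n, unitArr a b q j = if j = b then 1 else 0 := by
    intro a b ha
    by_cases hj : j = b <;> simp [unitArr, hj, ha]
  simp only [Pi.add_apply, Pi.sub_apply, Finset.sum_add_distrib, Finset.sum_sub_distrib]
  rw [hs _ _ hi, hs _ _ (by omega)]
  ring

theorem ColStep.rowSum_eq {j m : ℕ} {X Y : Arr} (hj : j + 1 < m) (h : ColStep j X Y) (a : ℕ) :
    ∑ b ∈ Finset.range m, Y a b = ∑ b ∈ Finset.range m, X a b :=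
  RowStep.colSum_eq hj h a

/-- A row-highest array vanishes below the diagonal. -/
theorem eq_zero_of_rowHighest {n m : ℕ} {X : Arr} (hX : Good n m X)
    (h : ∀ i, i + 1 < n → ∀ k, height i X k ≤ 0) : ∀ i j, j < i → X i j = 0 := by
  intro i
  induction i with
  | zero => intro j hj; omega
  | succ i ih =>
    intro j hj
    by_cases hi : i + 1 < n
    · have h1 := h i hi j
      -- Row `i` vanishes to the left of column `j ≤ i`, so the height at `j` is a sum of
      -- non-negative entries, one of which is `X (i + 1) j`.
      have h2 : ∑ q ∈ Finset.range j, X i q = 0 :=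
        Finset.sum_eq_zero fun q hq => ih q (by have := Finset.mem_range.1 hq; omega)
      rw [height, h2, sub_zero] at h1
      have h3 := Finset.single_le_sum (f := fun q => X (i + 1) q) (s := Finset.range (j + 1))
        (fun q _ => hX.nonneg (i + 1) q) (Finset.mem_range.2 (Nat.lt_succ_self j))
      exact le_antisymm (h3.trans h1) (hX.nonneg _ _)
    · exact hX.row_zero _ _ (not_lt.1 hi)

theorem eq_zero_of_colHighest {n m : ℕ} {X : Arr} (hX : Good n m X)
    (h : ∀ j, j + 1 < m → ∀ k, height j (tr X) k ≤ 0) : ∀ i j, i < j → X i j = 0 :=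
  fun i j hij => eq_zero_of_rowHighest hX.tr h j i hij

end Arrays

/-! ### Reading words of arrays, and the row and column crystals of matrices. -/

section Reading

variable {n : ℕ}

theorem pairing_eq_count (w : List (Fin n)) (i : Fin (n - 1)) :
    pairing (wordWt w) i = w.count (lo i) - w.count (hi i) := by
  simp [pairing, wordWt_apply]

/-- The weakly decreasing word with `X a j` letters `a`. -/
def colWord (n : ℕ) (X : Arr) (j : ℕ) : List (Fin n) :=
  (List.finRange n).reverse.flatMap fun a : Fin n => List.replicate (X a j).toNat a

/-- The reading word of the first `m` columns of an array. -/
def wordOf (n m : ℕ) (X : Arr) : List (Fin n) := (List.range m).flatMap (colWord n X)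

theorem wordOf_succ (m : ℕ) (X : Arr) : wordOf n (m + 1) X = wordOf n m X ++ colWord n X m := by
  simp [wordOf, List.range_succ]

theorem count_colWord (X : Arr) (j : ℕ) (a : Fin n) :
    (colWord n X j).count a = (X a j).toNat := by
  have h1 : ∀ x : Fin n, List.count a (List.replicate (X x j).toNat x) =
      if x = a then (X a j).toNat else 0 := by
    intro x
    rw [List.count_replicate]
    by_cases hx : x = a <;> simp [hx]
  simp only [colWord, List.count_flatMap, Function.comp_def, List.map_reverse,
    List.sum_reverse, h1, ← List.ofFn_eq_map, List.sum_ofFn]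
  simp

theorem count_wordOf {m : ℕ} {X : Arr} (hX : ∀ i j, 0 ≤ X i j) (a : Fin n) :
    ((wordOf n m X).count a : ℤ) = ∑ j ∈ Finset.range m, X a j := by
  induction m with
  | zero => simp [wordOf]
  | succ m ih =>
    rw [wordOf_succ, List.count_append, Finset.sum_range_succ, Nat.cast_add, ih, count_colWord,
      Int.toNat_of_nonneg (hX _ _)]

theorem pairing_wordOf {m : ℕ} {X : Arr} (hX : ∀ i j, 0 ≤ X i j) (i : Fin (n - 1)) :
    pairing (wordWt (wordOf n m X)) i =
      ∑ j ∈ Finset.range m, X i j - ∑ j ∈ Finset.range m, X (i + 1) j := by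
  rw [pairing_eq_count, count_wordOf hX, count_wordOf hX]
  rfl

theorem finRange_reverse_split (i : Fin (n - 1)) : ∃ P Q : List (Fin n),
    (List.finRange n).reverse = P ++ hi i :: lo i :: Q ∧ (hi i ∉ P ∧ lo i ∉ P) ∧
      hi i ∉ Q ∧ lo i ∉ Q := by
  have hi1 : (i : ℕ) + 1 < n := by omega
  have h1 : List.finRange n = (List.finRange n).take i ++
      lo i :: hi i :: (List.finRange n).drop (i + 1 + 1) := by
    have h2 : hi i = (List.finRange n)[(i : ℕ) + 1]'(by simpa using hi1) := by
      simp [hi]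
    have h3 : lo i = (List.finRange n)[(i : ℕ)]'(by simp; omega) := by
      simp [lo]
    rw [h2, List.getElem_cons_drop, h3, List.getElem_cons_drop, List.take_append_drop]
  generalize (List.finRange n).take i = A at h1
  generalize (List.finRange n).drop (i + 1 + 1) = B at h1
  have hnd := List.nodup_finRange n
  rw [h1] at hnd
  refine ⟨B.reverse, A.reverse, by rw [h1]; simp, ?_⟩
  simp only [List.nodup_append, List.nodup_cons, List.mem_cons] at hnd
  simp only [List.mem_reverse]
  obtain ⟨-, ⟨h2, h3, -⟩, h4⟩ := hnd
  refine ⟨⟨h3, fun h => h2 (Or.inr h)⟩, fun h => h4 _ h (hi i) (Or.inr (Or.inl rfl)) rfl,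
    fun h => h4 _ h (lo i) (Or.inl rfl) rfl⟩

theorem wordEps_eq_zero_of_not_mem {i : Fin (n - 1)} {w : List (Fin n)} (h₁ : hi i ∉ w)
    (h₂ : lo i ∉ w) : wordEps i w = 0 := by
  induction w with
  | nil => rfl
  | cons a w ih =>
    simp only [List.mem_cons, not_or] at h₁ h₂
    have := letter_other (Ne.symm h₁.1) (Ne.symm h₂.1)
    rw [wordEps, ih h₁.2 h₂.2]
    omega

theorem wordEps_replicate_hi (i : Fin (n - 1)) (y : ℕ) :
    wordEps i (List.replicate y (hi i)) = y := by
  have := letter_hi i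
  induction y with
  | zero => rfl
  | succ y ih => rw [List.replicate_succ, wordEps, ih]; push_cast; omega

theorem wordEps_replicate_lo (i : Fin (n - 1)) (x : ℕ) :
    wordEps i (List.replicate x (lo i)) = 0 := by
  have := letter_lo i
  induction x with
  | zero => rfl
  | succ x ih => rw [List.replicate_succ, wordEps, ih]; omega

theorem not_mem_flatMap_replicate {L : List (Fin n)} {a : Fin n} (h : a ∉ L) (c : Fin n → ℕ) :
    a ∉ L.flatMap fun b => List.replicate (c b) b := by
  rw [List.mem_flatMap]
  rintro ⟨b, hb, hab⟩
  rw [List.eq_of_mem_replicate hab] at h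
  exact h hb

/-- In a weakly decreasing word every `i + 1` precedes every `i`, so nothing cancels. -/
theorem wordEps_colWord {X : Arr} (hX : ∀ i j, 0 ≤ X i j) (i : Fin (n - 1)) (j : ℕ) :
    wordEps i (colWord n X j) = X (i + 1) j := by
  obtain ⟨P, Q, h, ⟨hP, lP⟩, hQ, lQ⟩ := finRange_reverse_split i
  have hh := lo_ne_hi i
  have hX' := hX (i + 1) j
  have e1 : wordEps i (List.replicate (X (hi i) j).toNat (hi i)) = X (i + 1) j := by
    rw [wordEps_replicate_hi, Int.toNat_of_nonneg (hX _ _)]; rfl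
  rw [colWord, h, List.flatMap_append, List.flatMap_cons, List.flatMap_cons, wordEps_append,
    wordEps_append, wordEps_append, wordEps_replicate_lo, e1,
    wordEps_eq_zero_of_not_mem (not_mem_flatMap_replicate hP _) (not_mem_flatMap_replicate lP _),
    wordEps_eq_zero_of_not_mem (not_mem_flatMap_replicate hQ _) (not_mem_flatMap_replicate lQ _)]
  simp only [pairing_eq_count, List.count_eq_zero_of_not_mem (not_mem_flatMap_replicate hP _),
    List.count_eq_zero_of_not_mem (not_mem_flatMap_replicate lP _), List.count_replicate,
    beq_iff_eq, hh, hh.symm, if_true, if_false, Int.toNat_of_nonneg (hX _ _)]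
  change max 0 (max (X (i + 1) j) (max 0 (0 - _) - (_ - X (i + 1) j)) - _) = _
  have := hX (lo i) j
  push_cast
  omega

/-- `ε` is the largest excess of `i + 1` over `i` in a prefix. Within a column the excess peaks
after its last `i + 1`, which is where `height` is measured; `0 ≤ z` accounts for the empty prefix.
-/
theorem wordEps_wordOf_le {X : Arr} (hX : ∀ i j, 0 ≤ X i j) (i : Fin (n - 1)) (m : ℕ) (z : ℤ) :
    wordEps i (wordOf n m X) ≤ z ↔ 0 ≤ z ∧ ∀ k < m, height i X k ≤ z := by
  induction m with
  | zero => simp [wordOf, wordEps]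
  | succ m ih =>
    have h1 : wordEps i (colWord n X m) - pairing (wordWt (wordOf n m X)) i = height i X m := by
      rw [wordEps_colWord hX, pairing_wordOf hX, height, Finset.sum_range_succ]
      ring
    rw [wordOf_succ, wordEps_append, max_le_iff, ih, h1]
    constructor
    · rintro ⟨⟨h2, h3⟩, h4⟩
      refine ⟨h2, fun k hk => ?_⟩
      rcases Nat.lt_succ_iff_lt_or_eq.1 hk with hk | rfl
      · exact h3 k hk
      · exact h4
    · rintro ⟨h2, h3⟩
      exact ⟨⟨h2, fun k hk => h3 k (by omega)⟩, h3 m (by omega)⟩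

theorem height_le_iff {i m : ℕ} {X : Arr} (hX : Good n m X) (z : ℤ) :
    (0 ≤ z ∧ ∀ k < m, height i X k ≤ z) ↔ ∀ k, height i X k ≤ z := by
  constructor
  · rintro ⟨h1, h2⟩ k
    rcases lt_or_ge k m with hk | hk
    · exact h2 k hk
    · rw [height_stable hX hk]
      cases m with
      | zero => rw [height_zero, hX.col_zero _ _ le_rfl]; exact h1
      | succ m =>
        have := h2 m (by omega)
        have := hX.nonneg i m
        rw [height_succ, hX.col_zero _ _ le_rfl]
        omega
  · intro h
    refine ⟨?_, fun k _ => h k⟩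
    have := h 0
    rw [height_zero] at this
    exact (hX.nonneg _ _).trans this

theorem wordEps_le_iff {m : ℕ} {X : Arr} (hX : Good n m X) (i : Fin (n - 1)) (z : ℤ) :
    wordEps i (wordOf n m X) ≤ z ↔ ∀ k, height i X k ≤ z := by
  rw [wordEps_wordOf_le hX.nonneg, height_le_iff hX]

theorem colWord_congr {X Y : Arr} {j : ℕ} (h : ∀ a, X a j = Y a j) :
    colWord n X j = colWord n Y j := by
  simp only [colWord, h]

/-- A new last `i + 1` and a new first `i` of column `k` are inserted at the same place, between the
two adjacent blocks of equal letters. Moving a unit between rows `i + 1` and `i` thus changes one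
letter of the word. -/
theorem wordOf_split {B : Arr} (hB : ∀ i j, 0 ≤ B i j) (i : Fin (n - 1)) {k m : ℕ} (hk : k < m) :
    ∃ u v, wordOf n m B = u ++ v ∧
      wordOf n m (B + unitArr (i + 1) k) = u ++ hi i :: v ∧
      wordOf n m (B + unitArr i k) = u ++ lo i :: v ∧
      pairing (wordWt u) i = - height i B k := by
  obtain ⟨P, Q, h, ⟨hP, lP⟩, hQ, lQ⟩ := finRange_reverse_split i
  have hh := lo_ne_hi i
  obtain ⟨R, hR, hkR⟩ : ∃ R, List.range m = List.range k ++ k :: R ∧ k ∉ R := by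
    refine ⟨(List.range m).drop (k + 1), ?_, ?_⟩
    · have h3 : k = (List.range m)[k]'(by simpa using hk) := by simp
      have h4 : List.range k = (List.range m).take k := by
        rw [List.take_range, min_eq_left hk.le]
      have h5 : k :: (List.range m).drop (k + 1) = (List.range m).drop k := by
        rw [← List.getElem_cons_drop (as := List.range m) (i := k) (by simpa using hk),
          List.getElem_range]
      rw [h4, h5, List.take_append_drop]
    · rw [List.mem_iff_getElem]
      rintro ⟨q, hq, h⟩
      simp at h
      omega
  have hother : ∀ (L : List ℕ) (c : ℕ), k ∉ L →
      L.flatMap (colWord n (B + unitArr c k)) = L.flatMap (colWord n B) := by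
    intro L c hL
    refine List.flatMap_congr fun j hj => colWord_congr fun a => ?_
    have : j ≠ k := fun h => hL (h ▸ hj)
    simp [unitArr, this]
  have hletters : ∀ (L : List (Fin n)) (c : Fin n), c ∉ L →
      (L.flatMap fun a : Fin n => List.replicate ((B + unitArr c k) a k).toNat a) =
        L.flatMap fun a : Fin n => List.replicate (B a k).toNat a := by
    intro L c hL
    refine List.flatMap_congr fun a ha => ?_
    have : (a : ℕ) ≠ c := fun h => hL (Fin.ext h ▸ ha)
    simp [unitArr, this]
  have hsame : ∀ c : Fin n, ((B + unitArr c k) c k).toNat = (B c k).toNat + 1 := by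
    intro c
    have := hB c k
    simp only [Pi.add_apply, unitArr, and_self, if_true]
    omega
  have hdiff : ∀ c d : Fin n, c ≠ d → ((B + unitArr c k) d k).toNat = (B d k).toNat := by
    intro c d hcd
    have : (d : ℕ) ≠ c := fun h => hcd (Fin.ext h.symm)
    simp [unitArr, this]
  have hkk : k ∉ List.range k := by simp
  refine ⟨wordOf n k B ++ ((P.flatMap fun a : Fin n => List.replicate (B a k).toNat a) ++
    List.replicate (B (hi i) k).toNat (hi i)), (List.replicate (B (lo i) k).toNat (lo i) ++
    Q.flatMap fun a : Fin n => List.replicate (B a k).toNat a) ++ R.flatMap (colWord n B), ?_, ?_, ?_, ?_⟩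
  · simp [wordOf, hR, colWord, h]
  · change wordOf n m (B + unitArr (hi i : ℕ) k) = _
    rw [wordOf, hR, List.flatMap_append, List.flatMap_cons, hother _ _ hkk, hother _ _ hkR,
      colWord, h, List.flatMap_append, List.flatMap_cons, List.flatMap_cons, hletters _ _ hP,
      hletters _ _ hQ, hsame, hdiff _ _ hh.symm, List.replicate_succ']
    simp [wordOf]
  · change wordOf n m (B + unitArr (lo i : ℕ) k) = _
    rw [wordOf, hR, List.flatMap_append, List.flatMap_cons, hother _ _ hkk, hother _ _ hkR,
      colWord, h, List.flatMap_append, List.flatMap_cons, List.flatMap_cons, hletters _ _ lP,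
      hletters _ _ lQ, hsame, hdiff _ _ hh, List.replicate_succ]
    simp [wordOf]
  · rw [wordWt_append, pairing_add, pairing_wordOf hB, pairing_eq_count, List.count_append,
      List.count_append, List.count_eq_zero_of_not_mem (not_mem_flatMap_replicate hP _),
      List.count_eq_zero_of_not_mem (not_mem_flatMap_replicate lP _)]
    simp only [List.count_replicate, beq_iff_eq, hh.symm, if_true, if_false]
    push_cast
    rw [Int.toNat_of_nonneg (hB _ _), height, Finset.sum_range_succ]
    change _ + (0 + 0 - (0 + B (i + 1) k)) = _
    ring

theorem RowStep.wordE {m : ℕ} {X Y : Arr} (hX : Good n m X) {i : Fin (n - 1)}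
    (h : RowStep i X Y) : wordE i (wordOf n m X) = some (wordOf n m Y) := by
  obtain ⟨k, hk, hp, rfl⟩ := h
  have hpos := hk.entry_pos hX hp
  have hkm : k < m := by
    by_contra hkm
    rw [hX.col_zero _ _ (not_lt.1 hkm)] at hpos
    exact lt_irrefl _ hpos
  -- `B` is the array with the moved letter deleted, the common part of `X` and its image.
  set B := X - unitArr (i + 1) k with hB
  have hB0 : ∀ a b, 0 ≤ B a b := by
    intro a b
    have := hX.nonneg a b
    simp only [hB, Pi.sub_apply, unitArr]
    split_ifs with h
    · obtain ⟨rfl, rfl⟩ := h; omega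
    · omega
  have hheight : ∀ l, height i B l = height i X l - if k ≤ l then 1 else 0 := by
    intro l
    rw [hB, height_sub, height_unitArr]
    simp
  obtain ⟨u, v, h1, h2, h3, h4⟩ := wordOf_split hB0 i hkm
  have hX' : X = B + unitArr (i + 1) k := by rw [hB]; abel
  have hk1 := hheight k
  rw [if_pos le_rfl] at hk1
  -- Deleting the letter lowers the heights from `k` on by one, while those before `k` were already
  -- strictly smaller than the maximum. Since `height i B k` is minus the pairing of `u`, this bound
  -- yields both `φ u = 0` and `ε v = 0`.
  have h5 : wordEps i (u ++ v) ≤ height i B k := by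
    rw [← h1, wordEps_wordOf_le hB0]
    refine ⟨by omega, fun l _ => ?_⟩
    have := hheight l
    have h6 := hk.2 l
    by_cases hkl : k ≤ l
    · rw [if_pos hkl] at this; omega
    · have h7 := hk.1 l (not_le.1 hkl)
      rw [if_neg hkl] at this; omega
  rw [wordEps_append] at h5
  rw [h3, hX', h2]
  have h6 := wordPhi_eq i u
  have h7 := wordPhi_nonneg i u
  have h8 := wordEps_nonneg i v
  exact wordE_append_hi (by omega) (by omega)

/-- A matrix as an array. -/
def toArr (M : Mat n) : Arr := fun i j => if h : i < n ∧ j < n then (M ⟨i, h.1⟩ ⟨j, h.2⟩ : ℤ) else 0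

theorem toArr_apply (M : Mat n) (i j : Fin n) : toArr M i j = M i j := by
  simp [toArr]

theorem toArr_good (M : Mat n) : Good n n (toArr M) := by
  refine ⟨fun i j => ?_, fun i j hi => ?_, fun i j hj => ?_⟩
  · rw [toArr]; split_ifs
    · exact Int.natCast_nonneg _
    · exact le_rfl
  · rw [toArr, dif_neg (by omega)]
  · rw [toArr, dif_neg (by omega)]

theorem toArr_injective : Function.Injective (toArr : Mat n → Arr) := by
  intro M M' h
  ext i j
  have := congrFun (congrFun h i) j
  rw [toArr_apply, toArr_apply] at this
  exact_mod_cast this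

theorem toArr_transpose (M : Mat n) : toArr M.transpose = tr (toArr M) := by
  funext i j
  simp only [toArr, tr, Matrix.transpose_apply, and_comm]

theorem Good.exists_toArr {X : Arr} (h : Good n n X) : ∃ M : Mat n, toArr M = X := by
  refine ⟨fun i j => (X i j).toNat, ?_⟩
  funext i j
  simp only [toArr]
  split_ifs with hij
  · exact Int.toNat_of_nonneg (h.nonneg _ _)
  · by_cases hi : i < n
    · exact (h.col_zero i j (by omega)).symm
    · exact (h.row_zero i j (by omega)).symm

theorem flatMap_range_eq {α : Type*} (f : ℕ → List α) :
    (List.range n).flatMap f = (List.finRange n).flatMap fun j : Fin n => f j := by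
  rw [← List.map_coe_finRange_eq_range, List.flatMap_map]

theorem wordA_eq (M : Mat n) : wordA M = wordOf n n (toArr M) := by
  rw [wordOf, flatMap_range_eq]
  simp only [wordA, biword, colWord, List.map_flatMap, List.map_replicate, toArr_apply,
    Int.toNat_natCast]

theorem flatMap_replicate_const {α β : Type*} (L : List α) (f : α → ℕ) (c : β) :
    (L.flatMap fun i => List.replicate (f i) c) = List.replicate (L.map f).sum c := by
  induction L with
  | nil => rfl
  | cons a L ih => rw [List.flatMap_cons, ih, List.map_cons, List.sum_cons, List.replicate_add]

theorem wordB_eq (M : Mat n) :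
    wordB M = (List.finRange n).flatMap fun j => List.replicate (∑ i, M i j) j := by
  simp only [wordB, biword, List.map_flatMap, List.map_replicate]
  refine List.flatMap_congr fun j _ => ?_
  rw [flatMap_replicate_const, List.map_reverse, List.sum_reverse, ← List.ofFn_eq_map,
    List.sum_ofFn]

theorem sum_toArr (M : Mat n) (j : Fin n) : ∑ a ∈ Finset.range n, toArr M a j = ∑ i, M i j := by
  rw [Finset.sum_range]
  push_cast
  exact Finset.sum_congr rfl fun i _ => toArr_apply M i j

theorem rowWt_apply (M : Mat n) (a : Fin n) : (rowCrystal n).wt M a = ∑ j, (M a j : ℤ) := by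
  change wordWt (wordA M) a = _
  rw [wordWt_apply, wordA_eq, count_wordOf (toArr_good M).nonneg, Finset.sum_range]
  exact Finset.sum_congr rfl fun j _ => toArr_apply M a j

theorem lt_of_index (i : Fin (n - 1)) : (i : ℕ) + 1 < n := by omega

/-- The word `b` depends only on the column sums, which a row step preserves. -/
theorem RowStep.ofBiword_zip {i : Fin (n - 1)} {M M' : Mat n} (h : RowStep i (toArr M) (toArr M')) :
    ofBiword ((wordA M').zip (wordB M)) = M' := by
  have : wordB M = wordB M' := by
    rw [wordB_eq, wordB_eq]
    refine List.flatMap_congr fun j _ => ?_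
    have := h.colSum_eq (lt_of_index i) j
    rw [sum_toArr, sum_toArr] at this
    rw [Nat.cast_inj.1 this]
  have h2 : (wordA M').zip (wordB M') = biword M' := by
    rw [wordA, wordB, ← List.unzip_fst, ← List.unzip_snd, List.zip_unzip]
  rw [this, h2, ofBiword_biword]

theorem RowStep.wordE_wordA {i : Fin (n - 1)} {M M' : Mat n} (h : RowStep i (toArr M) (toArr M')) :
    DiagCrystal.wordE i (wordA M) = some (wordA M') := by
  rw [wordA_eq, wordA_eq]
  exact h.wordE (toArr_good M)

theorem RowStep.rowColSum {i : Fin (n - 1)} {M M' : Mat n} (h : RowStep i (toArr M) (toArr M'))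
    (j : Fin n) : ∑ a, (M' a j : ℤ) = ∑ a, (M a j : ℤ) := by
  have := h.colSum_eq (lt_of_index i) j
  rw [sum_toArr, sum_toArr] at this
  exact_mod_cast this

theorem rowEps_le_iff (i : Fin (n - 1)) (M : Mat n) (z : ℤ) :
    (rowCrystal n).eps i M ≤ z ↔ ∀ k, height i (toArr M) k ≤ z := by
  change wordEps i (wordA M) ≤ z ↔ _
  rw [wordA_eq, wordEps_le_iff (toArr_good M)]

theorem exists_height_pos {m : ℕ} {X : Arr} (hX : Good n m X) {i : Fin (n - 1)}
    (h : 0 < wordEps i (wordOf n m X)) : ∃ k, 0 < height i X k := by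
  by_contra! hc
  exact h.not_ge ((wordEps_le_iff hX i 0).2 hc)

theorem exists_height_gt {m : ℕ} {X : Arr} (hX : Good n m X) {i : Fin (n - 1)}
    (h : 0 < wordPhi i (wordOf n m X)) : ∃ k, height i X m < height i X k := by
  by_contra! hc
  have h1 := (wordEps_le_iff hX i _).2 hc
  rw [wordPhi_eq, pairing_wordOf hX.nonneg] at h
  have hh : height i X m = ∑ j ∈ Finset.range m, X (i + 1) j - ∑ j ∈ Finset.range m, X i j := by
    rw [height, Finset.sum_range_succ, hX.col_zero _ _ le_rfl, add_zero]
  omega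

/-- For the forward direction, a nonzero value makes `ε` positive, so some row step exists; by `key`
its result is the value of the operator. -/
theorem rowE_iff {i : Fin (n - 1)} {M M' : Mat n} :
    (rowCrystal n).e i M = some M' ↔ RowStep i (toArr M) (toArr M') := by
  have key : ∀ M', RowStep i (toArr M) (toArr M') → (rowCrystal n).e i M = some M' := by
    intro M' h
    change (wordE i (wordA M)).map _ = _
    rw [h.wordE_wordA, Option.map_some, h.ofBiword_zip]
  refine ⟨fun h => ?_, key M'⟩
  obtain ⟨w, hw, -⟩ := Option.map_eq_some_iff.1 h
  have hp : 0 < wordEps i (wordA M) := by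
    refine lt_of_le_of_ne (wordEps_nonneg _ _) fun h0 => ?_
    rw [wordE_eq_none h0.symm] at hw
    cases hw
  rw [wordA_eq] at hp
  obtain ⟨Y, hY⟩ := exists_rowStep (toArr_good M) (exists_height_pos (toArr_good M) hp)
  obtain ⟨M₁, rfl⟩ := (hY.good (lt_of_index i) (toArr_good M)).exists_toArr
  rw [key M₁ hY, Option.some_inj] at h
  exact h ▸ hY

theorem rowF_iff {i : Fin (n - 1)} {M M' : Mat n} :
    (rowCrystal n).f i M = some M' ↔ RowStep i (toArr M') (toArr M) := by
  have key : ∀ M', RowStep i (toArr M') (toArr M) → (rowCrystal n).f i M = some M' := by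
    intro M' h
    change (wordF i (wordA M)).map _ = _
    have hB : wordB M = wordB M' := by
      rw [wordB_eq, wordB_eq]
      refine List.flatMap_congr fun j _ => ?_
      have := h.rowColSum j
      rw [show ∑ i, M i j = ∑ i, M' i j by exact_mod_cast this]
    have h2 : (wordA M').zip (wordB M') = biword M' := by
      rw [wordA, wordB, ← List.unzip_fst, ← List.unzip_snd, List.zip_unzip]
    rw [wordF_iff_wordE.2 h.wordE_wordA, Option.map_some, hB, h2, ofBiword_biword]
  refine ⟨fun h => ?_, key M'⟩
  obtain ⟨w, hw, -⟩ := Option.map_eq_some_iff.1 h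
  have hp : 0 < wordPhi i (wordA M) := by
    refine lt_of_le_of_ne (wordPhi_nonneg _ _) fun h0 => ?_
    rw [wordF_eq_none h0.symm] at hw
    cases hw
  rw [wordA_eq] at hp
  obtain ⟨Y, hg, hY⟩ := exists_rowStep_to (lt_of_index i) (toArr_good M)
    (exists_height_gt (toArr_good M) hp)
  obtain ⟨M₁, rfl⟩ := hg.exists_toArr
  rw [key M₁ hY, Option.some_inj] at h
  exact h ▸ hY

theorem rowF_iff_rowE {i : Fin (n - 1)} {M M' : Mat n} :
    (rowCrystal n).f i M = some M' ↔ (rowCrystal n).e i M' = some M := by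
  rw [rowF_iff, rowE_iff]

theorem rowCrystal_isCrystal : (rowCrystal n).IsCrystal where
  phi_eq i _ := wordPhi_eq i _
  e_some _ _ _ h := wordE_spec (rowE_iff.1 h).wordE_wordA
  f_some _ _ _ h := wordCrystal_isCrystal.f_some _ _ _
    (wordF_iff_wordE.2 (rowF_iff.1 h).wordE_wordA)
  f_iff_e _ _ _ := rowF_iff_rowE

theorem colE_iff {i : Fin (n - 1)} {M M' : Mat n} :
    (colCrystal n).e i M = some M' ↔ ColStep i (toArr M) (toArr M') := by
  change ((rowCrystal n).e i M.transpose).map Matrix.transpose = some M' ↔ RowStep _ _ _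
  rw [← toArr_transpose, ← toArr_transpose, ← rowE_iff, Option.map_eq_some_iff]
  constructor
  · rintro ⟨a, ha, rfl⟩; exact ha
  · intro h; exact ⟨_, h, rfl⟩

theorem colF_iff {i : Fin (n - 1)} {M M' : Mat n} :
    (colCrystal n).f i M = some M' ↔ ColStep i (toArr M') (toArr M) := by
  change ((rowCrystal n).f i M.transpose).map Matrix.transpose = some M' ↔ RowStep _ _ _
  rw [← toArr_transpose, ← toArr_transpose, ← rowF_iff, Option.map_eq_some_iff]
  constructor
  · rintro ⟨a, ha, rfl⟩; exact ha
  · intro h; exact ⟨_, h, rfl⟩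

theorem colEps_le_iff (i : Fin (n - 1)) (M : Mat n) (z : ℤ) :
    (colCrystal n).eps i M ≤ z ↔ ∀ k, height i (tr (toArr M)) k ≤ z := by
  rw [← toArr_transpose]
  exact rowEps_le_iff i _ z

theorem colWt_apply (M : Mat n) (a : Fin n) : (colCrystal n).wt M a = ∑ i, (M i a : ℤ) :=
  rowWt_apply M.transpose a

end Reading

/-! ### Seminormal crystals. -/

namespace CrystalData

variable {n : ℕ} {B B' : Type*}

/-- `ε` and `φ` are non-negative, and the operators do not vanish where they are positive. -/
structure IsSeminormal (C : CrystalData n B) : Prop where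
  eps_nonneg : ∀ i b, 0 ≤ C.eps i b
  phi_nonneg : ∀ i b, 0 ≤ C.phi i b
  exists_e : ∀ i b, 0 < C.eps i b → ∃ b', C.e i b = some b'
  exists_f : ∀ i b, 0 < C.phi i b → ∃ b', C.f i b = some b'

theorem IsSeminormal.eps_eq_zero {C : CrystalData n B} (h : C.IsSeminormal) {i : Fin (n - 1)}
    {b : B} (hb : C.e i b = none) : C.eps i b = 0 := by
  by_contra hne
  obtain ⟨b', hb'⟩ := h.exists_e i b (lt_of_le_of_ne (h.eps_nonneg i b) (Ne.symm hne))
  rw [hb] at hb'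
  cases hb'

theorem IsSeminormal.e_eq_none {C : CrystalData n B} (h : C.IsSeminormal) (hC : C.IsCrystal)
    {i : Fin (n - 1)} {b : B} (hb : C.eps i b = 0) : C.e i b = none := by
  rw [Option.eq_none_iff_forall_ne_some]
  intro b' hb'
  have h1 := (hC.e_some i b b' hb').1
  have h2 := h.eps_nonneg i b'
  omega

theorem IsSeminormal.eps_pos {C : CrystalData n B} (h : C.IsSeminormal) (hC : C.IsCrystal)
    {i : Fin (n - 1)} {b b' : B} (hb : C.e i b = some b') : 0 < C.eps i b := by
  have h1 := (hC.e_some i b b' hb).1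
  have h2 := h.eps_nonneg i b'
  omega

theorem IsSeminormal.phi_pos {C : CrystalData n B} (h : C.IsSeminormal) (hC : C.IsCrystal)
    {i : Fin (n - 1)} {b b' : B} (hb : C.e i b' = some b) : 0 < C.phi i b := by
  have h1 := (hC.e_some i b' b hb).2.1
  have h2 := h.phi_nonneg i b'
  omega

end CrystalData

/-! ### The diagonal crystal and the stability of lower triangular matrices. -/

section Diagonal

variable {n : ℕ}

theorem rowCrystal_isSeminormal : (rowCrystal n).IsSeminormal where
  eps_nonneg i _ := wordEps_nonneg i _
  phi_nonneg i _ := wordPhi_nonneg i _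
  exists_e i b h := by
    obtain ⟨w, hw⟩ := exists_wordE h
    exact ⟨_, Option.map_eq_some_iff.2 ⟨w, hw, rfl⟩⟩
  exists_f i b h := by
    obtain ⟨w, hw⟩ := exists_wordF h
    exact ⟨_, Option.map_eq_some_iff.2 ⟨w, hw, rfl⟩⟩

theorem colCrystal_isSeminormal : (colCrystal n).IsSeminormal where
  eps_nonneg i _ := wordEps_nonneg i _
  phi_nonneg i _ := wordPhi_nonneg i _
  exists_e i b h := by
    obtain ⟨w, hw⟩ := rowCrystal_isSeminormal.exists_e i b.transpose h
    exact ⟨_, Option.map_eq_some_iff.2 ⟨w, hw, rfl⟩⟩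
  exists_f i b h := by
    obtain ⟨w, hw⟩ := rowCrystal_isSeminormal.exists_f i b.transpose h
    exact ⟨_, Option.map_eq_some_iff.2 ⟨w, hw, rfl⟩⟩

theorem colCrystal_isCrystal : (colCrystal n).IsCrystal where
  phi_eq i b := rowCrystal_isCrystal.phi_eq i b.transpose
  e_some i b b' h := by
    obtain ⟨c, hc, rfl⟩ := Option.map_eq_some_iff.1 h
    exact rowCrystal_isCrystal.e_some i b.transpose c hc
  f_some i b b' h := by
    obtain ⟨c, hc, rfl⟩ := Option.map_eq_some_iff.1 h
    exact rowCrystal_isCrystal.f_some i b.transpose c hc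
  f_iff_e i b b' := by rw [colF_iff, colE_iff]

theorem colEps_of_rowE {i : Fin (n - 1)} {M M' : Mat n} (h : (rowCrystal n).e i M = some M')
    (j : Fin (n - 1)) : (colCrystal n).eps j M' = (colCrystal n).eps j M := by
  refine eq_of_forall_ge_iff fun z => ?_
  rw [colEps_le_iff, colEps_le_iff]
  exact (rowE_iff.1 h).height_tr_le_iff (toArr_good M) z

theorem colWt_of_rowE {i : Fin (n - 1)} {M M' : Mat n} (h : (rowCrystal n).e i M = some M') :
    (colCrystal n).wt M' = (colCrystal n).wt M := by
  funext a
  rw [colWt_apply, colWt_apply]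
  exact (rowE_iff.1 h).rowColSum a

theorem rowEps_of_colE {i : Fin (n - 1)} {M M' : Mat n} (h : (colCrystal n).e i M = some M')
    (j : Fin (n - 1)) : (rowCrystal n).eps j M' = (rowCrystal n).eps j M := by
  refine eq_of_forall_ge_iff fun z => ?_
  rw [rowEps_le_iff, rowEps_le_iff]
  exact (colE_iff.1 h).height_le_iff (toArr_good M) z

theorem rowWt_of_colE {i : Fin (n - 1)} {M M' : Mat n} (h : (colCrystal n).e i M = some M') :
    (rowCrystal n).wt M' = (rowCrystal n).wt M := by
  obtain ⟨c, hc, rfl⟩ := Option.map_eq_some_iff.1 h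
  exact colWt_of_rowE hc

theorem rowE_spec {i : Fin (n - 1)} {M M' : Mat n} (h : (rowCrystal n).e i M = some M') :
    (rowCrystal n).eps i M' = (rowCrystal n).eps i M - 1 ∧
    (rowCrystal n).phi i M' = (rowCrystal n).phi i M + 1 ∧
    (rowCrystal n).wt M' = (rowCrystal n).wt M + root i ∧
    (colCrystal n).eps i M' = (colCrystal n).eps i M ∧
    (colCrystal n).phi i M' = (colCrystal n).phi i M ∧
    (colCrystal n).wt M' = (colCrystal n).wt M := by
  obtain ⟨h1, h2, h3⟩ := rowCrystal_isCrystal.e_some _ _ _ h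
  refine ⟨h1, h2, h3, colEps_of_rowE h i, ?_, colWt_of_rowE h⟩
  rw [colCrystal_isCrystal.phi_eq, colCrystal_isCrystal.phi_eq, colEps_of_rowE h, colWt_of_rowE h]

theorem colE_spec {i : Fin (n - 1)} {M M' : Mat n} (h : (colCrystal n).e i M = some M') :
    (colCrystal n).eps i M' = (colCrystal n).eps i M - 1 ∧
    (colCrystal n).phi i M' = (colCrystal n).phi i M + 1 ∧
    (colCrystal n).wt M' = (colCrystal n).wt M + root i ∧
    (rowCrystal n).eps i M' = (rowCrystal n).eps i M ∧
    (rowCrystal n).phi i M' = (rowCrystal n).phi i M ∧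
    (rowCrystal n).wt M' = (rowCrystal n).wt M := by
  obtain ⟨h1, h2, h3⟩ := colCrystal_isCrystal.e_some _ _ _ h
  refine ⟨h1, h2, h3, rowEps_of_colE h i, ?_, rowWt_of_colE h⟩
  rw [rowCrystal_isCrystal.phi_eq, rowCrystal_isCrystal.phi_eq, rowEps_of_colE h, rowWt_of_colE h]

theorem diagE_eq_some_iff {i : Fin (n - 1)} {M M' : Mat n} :
    (diagCrystal n).e i M = some M' ↔
      ((colCrystal n).eps i M ≤ (rowCrystal n).phi i M ∧ (rowCrystal n).e i M = some M') ∨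
      ((rowCrystal n).phi i M < (colCrystal n).eps i M ∧ (colCrystal n).e i M = some M') := by
  simp only [diagCrystal]
  split_ifs with h
  · simp [h, not_lt.2 h]
  · simp [h, not_le.1 h]

theorem diagF_eq_some_iff {i : Fin (n - 1)} {M M' : Mat n} :
    (diagCrystal n).f i M = some M' ↔
      ((colCrystal n).eps i M < (rowCrystal n).phi i M ∧ (rowCrystal n).f i M = some M') ∨
      ((rowCrystal n).phi i M ≤ (colCrystal n).eps i M ∧ (colCrystal n).f i M = some M') := by
  simp only [diagCrystal]
  split_ifs with h
  · simp [h, not_le.2 h]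
  · simp [h, not_lt.1 h]

/-- The strict threshold for `f` matches the weak one for `e`: a row `e i` raises the row `φ` by one
and fixes the column `ε`, while a column `e i` lowers the column `ε` by one and fixes the row `φ`.
-/
theorem diagF_iff_diagE {i : Fin (n - 1)} {M M' : Mat n} :
    (diagCrystal n).f i M = some M' ↔ (diagCrystal n).e i M' = some M := by
  rw [diagF_eq_some_iff, diagE_eq_some_iff, rowF_iff_rowE, colCrystal_isCrystal.f_iff_e]
  refine or_congr (and_congr_left fun h => ?_) (and_congr_left fun h => ?_)
  · have := rowE_spec h
    omega
  · have := colE_spec h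
    omega

theorem diagE_spec {i : Fin (n - 1)} {M M' : Mat n} (h : (diagCrystal n).e i M = some M') :
    (diagCrystal n).eps i M' = (diagCrystal n).eps i M - 1 ∧
    (diagCrystal n).phi i M' = (diagCrystal n).phi i M + 1 ∧
    (diagCrystal n).wt M' = (diagCrystal n).wt M + root i := by
  have r1 := rowCrystal_isCrystal.phi_eq i M
  have c1 := colCrystal_isCrystal.phi_eq i M
  have hp := pairing_root i
  simp only [diagCrystal]
  rcases diagE_eq_some_iff.1 h with ⟨h1, h2⟩ | ⟨h1, h2⟩
  · obtain ⟨h3, h4, h5, h6, h7, h8⟩ := rowE_spec h2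
    rw [h3, h4, h5, h6, h7, h8, pairing_add]
    refine ⟨by omega, by omega, by abel⟩
  · obtain ⟨h3, h4, h5, h6, h7, h8⟩ := colE_spec h2
    rw [h3, h4, h5, h6, h7, h8, pairing_add]
    refine ⟨by omega, by omega, by abel⟩

theorem diagCrystal_isCrystal : (diagCrystal n).IsCrystal where
  phi_eq i b := by
    have r1 := rowCrystal_isCrystal.phi_eq i b
    have c1 := colCrystal_isCrystal.phi_eq i b
    simp only [diagCrystal]
    rw [pairing_add]
    omega
  e_some _ _ _ h := diagE_spec h
  f_some i b b' h := by
    obtain ⟨h1, h2, h3⟩ := diagE_spec (diagF_iff_diagE.1 h)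
    exact ⟨by omega, by omega, by rw [h3]; abel⟩
  f_iff_e _ _ _ := diagF_iff_diagE

theorem diagCrystal_isSeminormal : (diagCrystal n).IsSeminormal where
  eps_nonneg i b := le_max_of_le_left (rowCrystal_isSeminormal.eps_nonneg i b)
  phi_nonneg i b := le_max_of_le_right (colCrystal_isSeminormal.phi_nonneg i b)
  exists_e i b h := by
    have r1 := rowCrystal_isCrystal.phi_eq i b
    have r2 := rowCrystal_isSeminormal.phi_nonneg i b
    simp only [diagCrystal] at h ⊢
    split_ifs with h1
    · exact rowCrystal_isSeminormal.exists_e i b (by omega)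
    · exact colCrystal_isSeminormal.exists_e i b (by omega)
  exists_f i b h := by
    have c1 := colCrystal_isCrystal.phi_eq i b
    have r2 := colCrystal_isSeminormal.eps_nonneg i b
    simp only [diagCrystal] at h ⊢
    split_ifs with h1
    · exact rowCrystal_isSeminormal.exists_f i b (by omega)
    · exact colCrystal_isSeminormal.exists_f i b (by omega)

theorem diagWt_nonneg (M : Mat n) (a : Fin n) : 0 ≤ (diagCrystal n).wt M a := by
  simp only [diagCrystal, Pi.add_apply, rowWt_apply, colWt_apply]
  positivity

theorem mem_lowerMat_iff {M : Mat n} : M ∈ lowerMat n ↔ ∀ i j, i < j → toArr M i j = 0 := by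
  constructor
  · intro h i j hij
    simp only [toArr]
    split_ifs with hh
    · exact_mod_cast h ⟨i, hh.1⟩ ⟨j, hh.2⟩ hij
    · rfl
  · intro h i j hij
    have := h i j hij
    rw [toArr_apply] at this
    exact_mod_cast this

theorem height_toArr_eq (i : Fin (n - 1)) (M : Mat n) :
    height i (toArr M) n = - pairing ((rowCrystal n).wt M) i := by
  have hX := toArr_good M
  change _ = - pairing (wordWt (wordA M)) i
  rw [wordA_eq, pairing_wordOf hX.nonneg, height, Finset.sum_range_succ,
    hX.col_zero _ _ le_rfl, add_zero]
  ring

theorem rowPhi_le_iff (i : Fin (n - 1)) (M : Mat n) (z : ℤ) : (rowCrystal n).phi i M ≤ z ↔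
    ∀ k, height i (toArr M) k - height i (toArr M) n ≤ z := by
  have hh := height_toArr_eq i M
  have h1 := rowEps_le_iff i M (z + height i (toArr M) n)
  rw [rowCrystal_isCrystal.phi_eq]
  constructor
  · intro h k
    have := h1.1 (by omega) k
    omega
  · intro h
    have := h1.2 fun k => by have := h k; omega
    omega

theorem height_eq_of_lower {i n : ℕ} {X : Arr} (hX : Good n n X)
    (h : ∀ i j, i < j → X i j = 0) : height i X (i + 1) = height i X n := by
  have : ∀ l, i + 1 ≤ l → height i X l = height i X (i + 1) := by
    intro l hl
    induction l, hl using Nat.le_induction with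
    | base => rfl
    | succ l hl ih => rw [height_succ, ih, h i l hl, h (i + 1) (l + 1) (by omega)]; ring
  rcases le_total (i + 1) n with hn | hn
  · exact (this n hn).symm
  · exact height_stable hX hn

theorem height_tr_of_lower {i : ℕ} {X : Arr} (h : ∀ i j, i < j → X i j = 0) :
    height i (tr X) i = 0 := by
  rw [height, Finset.sum_eq_zero, Finset.sum_eq_zero, sub_zero]
  · intro q hq
    exact h q i (Finset.mem_range.1 hq)
  · intro q hq
    exact h q (i + 1) (Finset.mem_range.1 hq)

/-- Column moves go left and meet no obstacle. A row move goes up and could leave the triangle only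
from the diagonal entry `(i + 1, i + 1)`. Then the row height has its maximum at its final value, so
the row `φ` is `0`, while its strict rise there makes the column `ε` positive; the tensor product
rule would have chosen the column operator. -/
theorem lower_of_diagE {i : Fin (n - 1)} {M M' : Mat n} (hM : M ∈ lowerMat n)
    (h : (diagCrystal n).e i M = some M') : M' ∈ lowerMat n := by
  rw [mem_lowerMat_iff] at hM ⊢
  have hX := toArr_good M
  rcases diagE_eq_some_iff.1 h with ⟨h1, h2⟩ | ⟨-, h2⟩
  · obtain ⟨k, hk, hp, hY⟩ := rowE_iff.1 h2
    have hpos := hk.entry_pos hX hp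
    have hki : k ≤ i + 1 := by
      by_contra hlt
      rw [hM _ _ (not_le.1 hlt)] at hpos
      exact lt_irrefl _ hpos
    have hne : k ≠ i + 1 := by
      rintro rfl
      have h3 := hk.1 i (Nat.lt_succ_self _)
      have h4 := height_tr_sub i i (toArr M)
      rw [height_tr_of_lower hM] at h4
      have h5 := (colEps_le_iff i M _).1 le_rfl (i + 1)
      have h6 : (rowCrystal n).phi i M ≤ 0 := (rowPhi_le_iff i M 0).2 fun l => by
        rw [← height_eq_of_lower hX hM]
        have := hk.2 l
        omega
      omega
    intro a b hab
    rw [hY]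
    simp only [Pi.add_apply, Pi.sub_apply, unitArr, hM a b hab]
    rw [if_neg (by omega), if_neg (by omega)]; rfl
  · obtain ⟨l, hl, hp, hY⟩ := colStep_iff.1 (colE_iff.1 h2)
    have hpos := hl.entry_pos hX.tr hp
    have hli : i + 1 ≤ l := by
      by_contra hlt
      rw [tr, hM _ _ (not_le.1 hlt)] at hpos
      exact lt_irrefl _ hpos
    intro a b hab
    rw [hY]
    simp only [Pi.add_apply, Pi.sub_apply, unitArr, hM a b hab]
    rw [if_neg (by omega), if_neg (by omega)]; rfl

/-- Here `M'` is the image of `M` under the lowering operator. The only dangerous move takes the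
diagonal entry `(i, i)` to `(i, i + 1)` by a column operator. -/
theorem lower_of_diagF {i : Fin (n - 1)} {M M' : Mat n} (hM : M ∈ lowerMat n)
    (h : (diagCrystal n).e i M' = some M) : M' ∈ lowerMat n := by
  rw [mem_lowerMat_iff] at hM ⊢
  have hX := toArr_good M'
  rcases diagE_eq_some_iff.1 h with ⟨-, h2⟩ | ⟨h1, h2⟩
  · obtain ⟨k, -, -, hY⟩ := rowE_iff.1 h2
    have hY' : toArr M' = toArr M + unitArr (i + 1) k - unitArr i k := by rw [hY]; abel
    intro a b hab
    have h4 := hX.nonneg a b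
    have h6 := (toArr_good M).nonneg i k
    have h5 := hX.nonneg i k
    have h7 : k ≤ i := by
      by_contra hlt
      rw [hY', Pi.sub_apply, Pi.add_apply, Pi.sub_apply, Pi.add_apply, hM _ _ (not_le.1 hlt)] at h5
      simp [unitArr] at h5
    rw [hY']
    simp only [Pi.add_apply, Pi.sub_apply, unitArr, hM a b hab]
    rw [if_neg (by omega), if_neg (by omega)]; rfl
  · obtain ⟨l, hl, hp, hY⟩ := colStep_iff.1 (colE_iff.1 h2)
    have hY' : toArr M' = toArr M + unitArr l (i + 1) - unitArr l i := by rw [hY]; abel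
    have hil : i ≤ l := by
      by_contra hlt
      have h5 := hX.nonneg l i
      rw [hY', Pi.sub_apply, Pi.add_apply, Pi.sub_apply, Pi.add_apply, hM _ _ (not_le.1 hlt)] at h5
      simp [unitArr] at h5
    -- If `l = i`, the maximal column height of `M'` is its value at `i`, which is `1`. Its value at
    -- `i + 1` is then at most `1`, so that of `M` is at most `-1`, which gives `φ ≥ 1` for the rows
    -- of `M`, and so of `M'`. This contradicts the strict inequality `h1`.
    have hne : l ≠ i := by
      intro hli
      rw [hli] at hl hY
      have hT : tr (toArr M) = tr (toArr M') - unitArr (i + 1) i + unitArr i i := by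
        rw [hY, tr_move]
      have g1 := RowStep.height_eq hT i
      have g2 := RowStep.height_eq hT (i + 1)
      rw [if_pos le_rfl, if_neg (lt_irrefl _), height_tr_of_lower hM] at g1
      rw [if_pos (Nat.le_succ _), if_pos (Nat.lt_succ_self _)] at g2
      have g3 := hl.2 (i + 1)
      have g4 := height_tr_sub i i (toArr M)
      rw [height_tr_of_lower hM] at g4
      have g5 := (colEps_le_iff i M' (height i (tr (toArr M')) i)).2 hl.2
      have g6 := (rowPhi_le_iff i M _).1 le_rfl i
      rw [← height_eq_of_lower (toArr_good M) hM] at g6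
      have g7 := colE_spec h2
      omega
    intro a b hab
    rw [hY']
    simp only [Pi.add_apply, Pi.sub_apply, unitArr, hM a b hab]
    rw [if_neg (by omega), if_neg (by omega)]; rfl

end Diagonal

/-! ### Induced crystal structures. -/

namespace CrystalData

variable {n : ℕ} {B B' : Type*}

theorem comap_e_eq_some {C : CrystalData n B} {g : B' → B} (hg : Function.Injective g)
    {i : Fin (n - 1)} {y y' : B'} : (C.comap g).e i y = some y' ↔ C.e i (g y) = some (g y') := by
  simp only [comap, Option.bind_eq_some_iff]
  constructor
  · rintro ⟨b, hb, h⟩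
    rw [hb, (hg.isPartialInv y' b).1 h]
  · intro h
    exact ⟨_, h, Function.partialInv_left hg y'⟩

theorem comap_f_eq_some {C : CrystalData n B} {g : B' → B} (hg : Function.Injective g)
    {i : Fin (n - 1)} {y y' : B'} : (C.comap g).f i y = some y' ↔ C.f i (g y) = some (g y') := by
  simp only [comap, Option.bind_eq_some_iff]
  constructor
  · rintro ⟨b, hb, h⟩
    rw [hb, (hg.isPartialInv y' b).1 h]
  · intro h
    exact ⟨_, h, Function.partialInv_left hg y'⟩

theorem IsCrystal.comap {C : CrystalData n B} (hC : C.IsCrystal) {g : B' → B}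
    (hg : Function.Injective g) : (C.comap g).IsCrystal where
  phi_eq i b := hC.phi_eq i (g b)
  e_some i b b' h := hC.e_some i _ _ ((comap_e_eq_some hg).1 h)
  f_some i b b' h := hC.f_some i _ _ ((comap_f_eq_some hg).1 h)
  f_iff_e i b b' := by rw [comap_f_eq_some hg, comap_e_eq_some hg, hC.f_iff_e]

theorem IsSeminormal.restrict {C : CrystalData n B} (hC : C.IsSeminormal) {S : Set B}
    (hS : C.Stable S) : (C.restrict S).IsSeminormal where
  eps_nonneg i b := hC.eps_nonneg i b
  phi_nonneg i b := hC.phi_nonneg i b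
  exists_e i b h := by
    obtain ⟨b', hb'⟩ := hC.exists_e i b h
    exact ⟨⟨b', (hS i b b.2).1 b' hb'⟩, (comap_e_eq_some Subtype.val_injective).2 hb'⟩
  exists_f i b h := by
    obtain ⟨b', hb'⟩ := hC.exists_f i b h
    exact ⟨⟨b', (hS i b b.2).2 b' hb'⟩, (comap_f_eq_some Subtype.val_injective).2 hb'⟩

end CrystalData

/-! ### Semistandard tableaux as column-highest arrays. -/

section Tableaux

variable {n : ℕ}

/-- The length of row `j` of a partition, which is `0` for `n ≤ j`. -/
def Partn.rowLen (l : Partn n) (j : ℕ) : ℕ := if h : j < n then l.1 ⟨j, h⟩ else 0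

theorem Partn.rowLen_coe (l : Partn n) (j : Fin n) : l.rowLen j = l.1 j := by
  simp [rowLen]

theorem Partn.mem_diagram {l : Partn n} {j p : ℕ} : (j, p) ∈ l.diagram ↔ p < l.rowLen j := by
  rw [diagram, YoungDiagram.mem_ofRowLens, rowLen]
  simp only [List.length_ofFn, List.getElem_ofFn]
  split_ifs with h
  · simp [h]
  · simp [h]

/-- The array whose column `j` is the content of row `j` of a tableau. -/
def tabArr {l : Partn n} (T : Tableau l) : Arr := fun i j =>
  ((Finset.range (l.rowLen j)).filter fun p => T.1 j p = i).card

theorem sum_tabArr {l : Partn n} (T : Tableau l) (j k : ℕ) :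
    ∑ q ∈ Finset.range k, tabArr T q j =
      ((Finset.range (l.rowLen j)).filter fun p => T.1 j p < k).card := by
  rw [Finset.card_eq_sum_card_fiberwise (f := fun p => T.1 j p) (t := Finset.range k)]
  · push_cast
    refine Finset.sum_congr rfl fun b hb => ?_
    rw [tabArr, Finset.filter_filter]
    congr 2
    refine Finset.filter_congr fun p _ => ?_
    have := Finset.mem_range.1 hb
    constructor
    · rintro rfl; exact ⟨this, rfl⟩
    · exact fun h => h.2
  · intro p hp
    have := (Finset.mem_filter.1 hp).2
    simpa using this

theorem colSum_tabArr {l : Partn n} (T : Tableau l) (j : ℕ) :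
    ∑ q ∈ Finset.range n, tabArr T q j = l.rowLen j := by
  rw [sum_tabArr, Finset.filter_true_of_mem fun p _ => T.2 j p, Finset.card_range]

theorem tabArr_good {l : Partn n} (T : Tableau l) : Good n n (tabArr T) := by
  refine ⟨fun i j => Int.natCast_nonneg _, fun i j hi => ?_, fun i j hj => ?_⟩
  · rw [tabArr, Finset.filter_false_of_mem]
    · rfl
    · intro p _
      exact ((T.2 j p).trans_le hi).ne
  · rw [tabArr, Partn.rowLen, dif_neg (not_lt.2 hj)]
    rfl

/-- Column strictness: above an entry `≤ k` of row `j + 1` there is an entry `< k` of row `j`. -/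
theorem tabArr_colHighest {l : Partn n} (T : Tableau l) (j k : ℕ) :
    height j (tr (tabArr T)) k ≤ 0 := by
  have h1 := sum_tabArr T (j + 1) (k + 1)
  have h2 := sum_tabArr T j k
  have h3 : ((Finset.range (l.rowLen (j + 1))).filter fun p => T.1 (j + 1) p < k + 1).card ≤
      ((Finset.range (l.rowLen j)).filter fun p => T.1 j p < k).card := by
    refine Finset.card_le_card fun p hp => ?_
    simp only [Finset.mem_filter, Finset.mem_range, ← Partn.mem_diagram] at hp ⊢
    refine ⟨l.diagram.up_left_mem (Nat.le_succ j) le_rfl hp.1, ?_⟩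
    have := T.1.col_strict (show j < j + 1 by omega) hp.1
    omega
  change ∑ q ∈ Finset.range (k + 1), tabArr T q (j + 1) - ∑ q ∈ Finset.range k, tabArr T q j ≤ 0
  omega

/-- Row by row, both words are weakly decreasing with the same content. -/
theorem reading_eq {l : Partn n} (T : Tableau l) : reading T = wordOf n n (tabArr T) := by
  rw [wordOf, flatMap_range_eq, reading]
  refine List.flatMap_congr fun j _ => ?_
  refine List.Perm.eq_of_pairwise (le := fun a b : Fin n => b ≤ a)
    (fun a b _ _ h₁ h₂ => le_antisymm h₂ h₁) ?_ ?_ ?_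
  · rw [List.pairwise_map, List.pairwise_reverse]
    refine (List.pairwise_lt_range).imp_of_mem fun {a b} _ hb hab => ?_
    rw [Fin.le_def]
    refine T.1.row_weak hab (Partn.mem_diagram.2 ?_)
    rw [Partn.rowLen_coe]
    exact List.mem_range.1 hb
  · rw [colWord, List.pairwise_flatMap]
    refine ⟨fun i _ => List.pairwise_replicate.2 (Or.inr le_rfl),
      (List.pairwise_reverse.2 (List.pairwise_lt_finRange n)).imp ?_⟩
    intro a b hab x hx y hy
    rw [List.eq_of_mem_replicate hx, List.eq_of_mem_replicate hy]
    exact hab.le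
  · rw [List.perm_iff_count]
    intro a
    rw [count_colWord, tabArr, Int.toNat_natCast, List.map_reverse, List.count_reverse,
      Partn.rowLen_coe, List.count, List.countP_map, List.countP_eq_length_filter,
      Finset.card_def, Finset.filter_val, Finset.range_val, ← Multiset.coe_range,
      Multiset.filter_coe, Multiset.coe_card]
    congr 1
    refine List.filter_congr fun p _ => ?_
    rw [Bool.eq_iff_iff]
    simp [Fin.ext_iff]

theorem flatMap_inj_of_length {α β : Type*} {L : List α} {f g : α → List β}
    (hl : ∀ a ∈ L, (f a).length = (g a).length) (h : L.flatMap f = L.flatMap g) :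
    ∀ a ∈ L, f a = g a := by
  induction L with
  | nil => simp
  | cons b L ih =>
    rw [List.flatMap_cons, List.flatMap_cons] at h
    obtain ⟨h1, h2⟩ := List.append_inj h (hl b (by simp))
    intro a ha
    rcases List.mem_cons.1 ha with rfl | ha
    · exact h1
    · exact ih (fun a ha => hl a (List.mem_cons_of_mem _ ha)) h2 a ha

theorem reading_injective (l : Partn n) : Function.Injective (reading : Tableau l → _) := by
  intro T T' h
  have h1 := flatMap_inj_of_length (by simp) h
  refine Subtype.ext (SemistandardYoungTableau.ext fun j p => ?_)
  by_cases hjp : (j, p) ∈ l.diagram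
  · have hp := Partn.mem_diagram.1 hjp
    have hj : j < n := by
      by_contra hj
      rw [Partn.rowLen, dif_neg hj] at hp
      exact absurd hp (Nat.not_lt_zero p)
    have h2 := h1 ⟨j, hj⟩ (List.mem_finRange _)
    rw [List.map_inj_left] at h2
    have h3 := h2 p (by simpa [Partn.rowLen, hj] using hp)
    exact congrArg Fin.val h3
  · rw [T.1.zeros hjp, T'.1.zeros hjp]

theorem tabArr_injective (l : Partn n) : Function.Injective (tabArr : Tableau l → _) := by
  intro T T' h
  refine reading_injective l ?_
  rw [reading_eq, reading_eq, h]

theorem colSum_mono {X : Arr} (hX : ∀ i j, 0 ≤ X i j) (j : ℕ) {a b : ℕ} (h : a ≤ b) :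
    ∑ q ∈ Finset.range a, X q j ≤ ∑ q ∈ Finset.range b, X q j :=
  Finset.sum_le_sum_of_subset_of_nonneg (Finset.range_subset_range.2 h) fun q _ _ => hX q j

/-- Column-highest arrays come from tableaux. -/
theorem exists_tabArr (hn : 0 < n) {l : Partn n} {X : Arr} (hX : Good n n X)
    (hh : ∀ j, j + 1 < n → ∀ k, height j (tr X) k ≤ 0)
    (hs : ∀ j < n, ∑ a ∈ Finset.range n, X a j = l.rowLen j) : ∃ T : Tableau l, tabArr T = X := by
  classical
  set P : ℕ → ℕ → ℤ := fun j a => ∑ q ∈ Finset.range a, X q j with hP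
  have hmono : ∀ j {a b}, a ≤ b → P j a ≤ P j b := fun j _ _ h => colSum_mono hX.nonneg j h
  have hs' : ∀ j, P j n = l.rowLen j := by
    intro j
    by_cases hj : j < n
    · exact hs j hj
    · rw [Partn.rowLen, dif_neg hj]
      exact Finset.sum_eq_zero fun q _ => hX.col_zero q j (not_lt.1 hj)
  -- The entry in position `p` of row `j` is the least letter `a` such that more than `p` letters of
  -- the row are at most `a`.
  set t : ℕ → ℕ → ℕ := fun j p => sInf {a | (p : ℤ) < P j (a + 1)} with ht
  have hlt : ∀ j p, p < l.rowLen j → ∀ a, t j p < a ↔ (p : ℤ) < P j a := by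
    intro j p hp a
    cases a with
    | zero => simp [hP]
    | succ a =>
      rw [Nat.lt_succ_iff]
      constructor
      · intro h
        have hmem : t j p ∈ {a | (p : ℤ) < P j (a + 1)} := by
          refine Nat.sInf_mem ⟨n, ?_⟩
          have := hmono j (show n ≤ n + 1 by omega)
          have := hs' j
          change (p : ℤ) < P j (n + 1)
          omega
        exact lt_of_lt_of_le hmem (hmono j (by omega))
      · intro h
        exact Nat.sInf_le h
  have hstep : ∀ j p, p < l.rowLen (j + 1) → t j p < t (j + 1) p := by
    intro j p hp
    have hp' := l.diagram.up_left_mem (Nat.le_succ j) le_rfl (Partn.mem_diagram.2 hp)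
    have hj : j + 1 < n := by
      by_contra hj
      rw [Partn.rowLen, dif_neg hj] at hp
      exact absurd hp (Nat.not_lt_zero p)
    rw [hlt j p (Partn.mem_diagram.1 hp')]
    have h1 := (hlt (j + 1) p hp (t (j + 1) p + 1)).1 (by omega)
    have h2 : P (j + 1) (t (j + 1) p + 1) - P j (t (j + 1) p) ≤ 0 := hh j hj _
    omega
  let T : SemistandardYoungTableau l.diagram :=
    { entry := fun j p => if (j, p) ∈ l.diagram then t j p else 0
      row_weak' := by
        intro j p q hpq hq
        have hp := l.diagram.up_left_mem le_rfl hpq.le hq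
        simp only [hp, hq, if_true]
        rw [← Nat.lt_succ_iff, hlt j p (Partn.mem_diagram.1 hp)]
        have := (hlt j q (Partn.mem_diagram.1 hq) _).1 (Nat.lt_succ_self _)
        omega
      col_strict' := by
        intro i j p hij hj
        have hi := l.diagram.up_left_mem hij.le le_rfl hj
        simp only [hi, hj, if_true]
        clear hi
        induction j, hij using Nat.le_induction with
        | base => exact hstep i p (Partn.mem_diagram.1 hj)
        | succ j hij ih =>
          exact (ih (l.diagram.up_left_mem (Nat.le_succ j) le_rfl hj)).trans
            (hstep j p (Partn.mem_diagram.1 hj))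
      zeros' := fun h => if_neg h }
  have hT : ∀ j p, T j p = if (j, p) ∈ l.diagram then t j p else 0 := fun _ _ => rfl
  refine ⟨⟨T, fun j p => ?_⟩, ?_⟩
  · rw [hT]
    split_ifs with h
    · have hp := Partn.mem_diagram.1 h
      rw [hlt j p hp, hs' j]
      exact_mod_cast hp
    -- Outside the diagram the entry is the default `0`, which has to be a letter.
    · exact hn
  · funext i j
    have h0 : 0 ≤ P j i := Finset.sum_nonneg fun q _ => hX.nonneg q j
    have h1 : P j (i + 1) = P j i + X i j := Finset.sum_range_succ _ _
    have h2 := hX.nonneg i j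
    have h4 : P j (i + 1) ≤ l.rowLen j := by
      rw [← hs' j]
      rcases le_total (i + 1) n with h | h
      · exact hmono j h
      · refine le_of_eq (Finset.sum_subset (Finset.range_subset_range.2 h) fun q _ hq => ?_).symm
        exact hX.row_zero q j (by simpa using hq)
    -- By `hlt`, the positions of the letter `i` in row `j` form the interval from the number of
    -- smaller letters to the number of letters at most `i`.
    have h3 : ((Finset.range (l.rowLen j)).filter fun p => T j p = i) =
        Finset.Ico (P j i).toNat (P j (i + 1)).toNat := by
      ext p
      simp only [Finset.mem_filter, Finset.mem_range, Finset.mem_Ico]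
      by_cases hp : p < l.rowLen j
      · rw [hT, if_pos (Partn.mem_diagram.2 hp)]
        have h5 := hlt j p hp i
        have h6 := hlt j p hp (i + 1)
        omega
      · omega
    change (((Finset.range (l.rowLen j)).filter fun p => T j p = i).card : ℤ) = X i j
    rw [h3, Nat.card_Ico]
    omega

/-- The column height condition at `n` compares two full column sums, so these decrease weakly. -/
theorem exists_shape {X : Arr} (hX : Good n n X)
    (hh : ∀ j, j + 1 < n → ∀ k, height j (tr X) k ≤ 0) :
    ∃ l : Partn n, ∀ j < n, ∑ a ∈ Finset.range n, X a j = l.rowLen j := by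
  have h0 : ∀ j, 0 ≤ ∑ a ∈ Finset.range n, X a j :=
    fun j => Finset.sum_nonneg fun a _ => hX.nonneg a j
  have hstep : ∀ j, j + 1 < n →
      ∑ a ∈ Finset.range n, X a (j + 1) ≤ ∑ a ∈ Finset.range n, X a j := by
    intro j hj
    have h1 := hh j hj n
    have h2 := colSum_mono hX.nonneg (j + 1) (show n ≤ n + 1 by omega)
    simp only [height, tr] at h1
    exact h2.trans (by omega)
  have hanti : ∀ j k, j ≤ k → k < n →
      ∑ a ∈ Finset.range n, X a k ≤ ∑ a ∈ Finset.range n, X a j := by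
    intro j k hjk
    induction k, hjk using Nat.le_induction with
    | base => exact fun _ => le_rfl
    | succ k hjk ih => exact fun hk => (hstep k hk).trans (ih (by omega))
  refine ⟨⟨fun j => (∑ a ∈ Finset.range n, X a j).toNat, fun j k hjk => ?_⟩, fun j hj => ?_⟩
  · exact Int.toNat_le_toNat (hanti j k hjk k.2)
  · simp only [Partn.rowLen, dif_pos hj, Int.toNat_of_nonneg (h0 j)]

theorem tableauCrystal_isCrystal (l : Partn n) : (tableauCrystal l).IsCrystal :=
  wordCrystal_isCrystal.comap (reading_injective l)

theorem tabEps_le_iff {l : Partn n} (i : Fin (n - 1)) (T : Tableau l) (z : ℤ) :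
    (tableauCrystal l).eps i T ≤ z ↔ ∀ k, height i (tabArr T) k ≤ z := by
  change wordEps i (reading T) ≤ z ↔ _
  rw [reading_eq, wordEps_le_iff (tabArr_good T)]

/-- Row steps preserve the column `ε` and the column sums, hence the class of arrays of tableaux of
shape `l`. -/
theorem RowStep.exists_tableau {l : Partn n} {i : Fin (n - 1)} {T : Tableau l} {Y : Arr}
    (h : RowStep i (tabArr T) Y) : ∃ T' : Tableau l, tabArr T' = Y := by
  refine exists_tabArr (by have := lt_of_index i; omega) (h.good (lt_of_index i) (tabArr_good T)) (fun j _ => ?_)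
    fun j _ => ?_
  · rw [h.height_tr_le_iff (tabArr_good T)]
    exact tabArr_colHighest T j
  · rw [h.colSum_eq (lt_of_index i), colSum_tabArr]

theorem RowStep.exists_tableau_to {l : Partn n} {i : Fin (n - 1)} {T : Tableau l} {X : Arr}
    (hX : Good n n X) (h : RowStep i X (tabArr T)) : ∃ T' : Tableau l, tabArr T' = X := by
  refine exists_tabArr (by have := lt_of_index i; omega) hX (fun j _ => ?_) fun j _ => ?_
  · rw [← h.height_tr_le_iff hX]
    exact tabArr_colHighest T j
  · rw [← h.colSum_eq (lt_of_index i), colSum_tabArr]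

theorem tabE_of_rowStep {l : Partn n} {i : Fin (n - 1)} {T T' : Tableau l}
    (h : RowStep i (tabArr T) (tabArr T')) : (tableauCrystal l).e i T = some T' := by
  refine (CrystalData.comap_e_eq_some (reading_injective l)).2 ?_
  rw [reading_eq, reading_eq]
  exact h.wordE (tabArr_good T)

theorem tabE_iff {l : Partn n} {i : Fin (n - 1)} {T T' : Tableau l} :
    (tableauCrystal l).e i T = some T' ↔ RowStep i (tabArr T) (tabArr T') := by
  refine ⟨fun h => ?_, tabE_of_rowStep⟩
  have hw := (CrystalData.comap_e_eq_some (reading_injective l)).1 h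
  have hp : 0 < wordEps i (reading T) := by
    refine lt_of_le_of_ne (wordEps_nonneg _ _) fun h0 => ?_
    have := wordE_eq_none h0.symm
    rw [show wordE i (reading T) = some (reading T') from hw] at this
    cases this
  rw [reading_eq] at hp
  obtain ⟨Y, hY⟩ := exists_rowStep (tabArr_good T) (exists_height_pos (tabArr_good T) hp)
  obtain ⟨T₁, rfl⟩ := hY.exists_tableau
  rw [tabE_of_rowStep hY, Option.some_inj] at h
  exact h ▸ hY

theorem tableauCrystal_isSeminormal (l : Partn n) : (tableauCrystal l).IsSeminormal where
  eps_nonneg i _ := wordEps_nonneg i _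
  phi_nonneg i _ := wordPhi_nonneg i _
  exists_e i T h := by
    change 0 < wordEps i (reading T) at h
    rw [reading_eq] at h
    obtain ⟨Y, hY⟩ := exists_rowStep (tabArr_good T) (exists_height_pos (tabArr_good T) h)
    obtain ⟨T₁, rfl⟩ := hY.exists_tableau
    exact ⟨T₁, tabE_of_rowStep hY⟩
  exists_f i T h := by
    change 0 < wordPhi i (reading T) at h
    rw [reading_eq] at h
    obtain ⟨Y, hg, hY⟩ := exists_rowStep_to (lt_of_index i) (tabArr_good T)
      (exists_height_gt (tabArr_good T) h)
    obtain ⟨T₁, rfl⟩ := hY.exists_tableau_to hg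
    exact ⟨T₁, ((tableauCrystal_isCrystal l).f_iff_e i T T₁).2 (tabE_of_rowStep hY)⟩

theorem tabWt_apply {l : Partn n} (T : Tableau l) (a : Fin n) :
    (tableauCrystal l).wt T a = ∑ j ∈ Finset.range n, tabArr T a j := by
  change wordWt (reading T) a = _
  rw [wordWt_apply, reading_eq, count_wordOf (tabArr_good T).nonneg]

end Tableaux

/-! ### Highest weight elements and an isomorphism criterion. -/

namespace CrystalData

variable {n : ℕ} {B B' : Type*}

/-- Reachability by the operators `e i`. -/
def Raise (C : CrystalData n B) : B → B → Prop :=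
  Relation.ReflTransGen fun b b' => ∃ i, C.e i b = some b'

/-- Highest weight elements. -/
def IsTop (C : CrystalData n B) (b : B) : Prop := ∀ i, C.e i b = none

theorem IsTop.eq_of_raise {C : CrystalData n B} {b b' : B} (h : C.IsTop b) (hr : C.Raise b b') :
    b = b' := by
  rcases Relation.ReflTransGen.cases_head hr with rfl | ⟨c, ⟨i, hi⟩, -⟩
  · rfl
  · rw [h i] at hi; cases hi

/-- Each `e i` lowers the statistic `∑ a * wt a` by one, so raising terminates when weights are
non-negative. -/
theorem sum_mul_root (i : Fin (n - 1)) : ∑ a : Fin n, (a : ℤ) * root i a = -1 := by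
  simp only [root, Pi.sub_apply, mul_sub, Finset.sum_sub_distrib, Pi.single_apply, mul_ite,
    mul_one, mul_zero, Finset.sum_ite_eq', Finset.mem_univ, if_true]
  simp [lo, hi]

theorem IsCrystal.exists_top {C : CrystalData n B} (hC : C.IsCrystal)
    (hw : ∀ b a, 0 ≤ C.wt b a) (b : B) : ∃ t, C.Raise b t ∧ C.IsTop t := by
  induction hd : (∑ a : Fin n, (a : ℤ) * C.wt b a).toNat using Nat.strong_induction_on
    generalizing b with
  | _ d ih =>
    by_cases hb : C.IsTop b
    · exact ⟨b, Relation.ReflTransGen.refl, hb⟩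
    · simp only [IsTop, not_forall] at hb
      obtain ⟨i, hi⟩ := hb
      obtain ⟨b', hb'⟩ := Option.ne_none_iff_exists'.1 hi
      have h1 := (hC.e_some i b b' hb').2.2
      have h2 : ∑ a : Fin n, (a : ℤ) * C.wt b' a = ∑ a : Fin n, (a : ℤ) * C.wt b a - 1 := by
        rw [h1]
        simp only [Pi.add_apply, mul_add, Finset.sum_add_distrib, sum_mul_root]
        ring
      have h3 : 0 ≤ ∑ a : Fin n, (a : ℤ) * C.wt b' a :=
        Finset.sum_nonneg fun a _ => mul_nonneg (Int.natCast_nonneg _) (hw b' a)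
      obtain ⟨t, ht, htt⟩ := ih _ (by omega) b' rfl
      exact ⟨t, Relation.ReflTransGen.head ⟨i, hb'⟩ ht, htt⟩

theorem IsCrystal.e_injective {C : CrystalData n B} (hC : C.IsCrystal) {i : Fin (n - 1)}
    {b c d : B} (hb : C.e i b = some d) (hc : C.e i c = some d) : b = c := by
  rw [← hC.f_iff_e] at hb hc
  rw [hb] at hc
  exact Option.some_inj.1 hc

theorem raise_restrict {C : CrystalData n B} {S : Set B} (hS : C.Stable S) {b c : B}
    (h : C.Raise b c) (hb : b ∈ S) : ∃ hc : c ∈ S, (C.restrict S).Raise ⟨b, hb⟩ ⟨c, hc⟩ := by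
  induction h with
  | refl => exact ⟨hb, Relation.ReflTransGen.refl⟩
  | tail _ h ih =>
    obtain ⟨hc, hr⟩ := ih
    obtain ⟨i, hi⟩ := h
    refine ⟨(hS i _ hc).1 _ hi, hr.tail ⟨i, ?_⟩⟩
    exact (comap_e_eq_some Subtype.val_injective).2 hi

/-- Two crystals with unique highest weight elements are isomorphic if they are related by a
left total relation that is compatible with the weight, with `ε` and with the operators `e i`. -/
theorem nonempty_iso [Nonempty B] {C : CrystalData n B} {C' : CrystalData n B'}
    (hC : C.IsCrystal) (hC' : C'.IsCrystal) (sC : C.IsSeminormal) (sC' : C'.IsSeminormal)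
    (wC : ∀ b a, 0 ≤ C.wt b a) (wC' : ∀ b a, 0 ≤ C'.wt b a)
    (uC : ∀ b c, C.IsTop b → C.IsTop c → b = c) (uC' : ∀ b c, C'.IsTop b → C'.IsTop c → b = c)
    (R : B → B' → Prop) (total : ∀ x, ∃ y, R x y)
    (R_wt : ∀ x y, R x y → C'.wt y = C.wt x) (R_eps : ∀ x y i, R x y → C'.eps i y = C.eps i x)
    (R_e : ∀ x y i x', R x y → C.e i x = some x' → ∃ y', C'.e i y = some y' ∧ R x' y') :
    Nonempty (Iso C C') := by
  have R_phi : ∀ x y i, R x y → C'.phi i y = C.phi i x := by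
    intro x y i h
    rw [hC.phi_eq, hC'.phi_eq, R_wt x y h, R_eps x y i h]
  have R_e' : ∀ x y i y', R x y → C'.e i y = some y' → ∃ x', C.e i x = some x' ∧ R x' y' := by
    intro x y i y' h hy
    have h1 := sC'.eps_pos hC' hy
    rw [R_eps x y i h] at h1
    obtain ⟨x', hx'⟩ := sC.exists_e i x h1
    obtain ⟨y₁, hy₁, hR⟩ := R_e x y i x' h hx'
    rw [hy, Option.some_inj] at hy₁
    exact ⟨x', hx', hy₁ ▸ hR⟩
  have R_none : ∀ x y i, R x y → (C.e i x = none ↔ C'.e i y = none) := by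
    intro x y i h
    constructor
    · intro hx
      exact sC'.e_eq_none hC' ((R_eps x y i h).trans (sC.eps_eq_zero hx))
    · intro hy
      exact sC.e_eq_none hC ((R_eps x y i h).symm.trans (sC'.eps_eq_zero hy))
  have R_top : ∀ x y, R x y → (C.IsTop x ↔ C'.IsTop y) :=
    fun x y h => forall_congr' fun i => R_none x y i h
  -- Raise `x` to a highest weight element, follow `y` and `y'` along to the unique one of `C'`, and
  -- come back by injectivity of each `e i`.
  have R_right : ∀ x y y', R x y → R x y' → y = y' := by
    intro x
    obtain ⟨t, hr, ht⟩ := hC.exists_top wC x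
    induction hr using Relation.ReflTransGen.head_induction_on with
    | refl => exact fun y y' h h' => uC' _ _ ((R_top _ _ h).1 ht) ((R_top _ _ h').1 ht)
    | head hs _ ih =>
      intro y y' h h'
      obtain ⟨i, hi⟩ := hs
      obtain ⟨y₁, h1, h2⟩ := R_e _ _ i _ h hi
      obtain ⟨y₂, h3, h4⟩ := R_e _ _ i _ h' hi
      rw [ih y₁ y₂ h2 h4] at h1
      exact hC'.e_injective h1 h3
  have R_left : ∀ y x x', R x y → R x' y → x = x' := by
    intro y
    obtain ⟨t, hr, ht⟩ := hC'.exists_top wC' y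
    induction hr using Relation.ReflTransGen.head_induction_on with
    | refl => exact fun x x' h h' => uC _ _ ((R_top _ _ h).2 ht) ((R_top _ _ h').2 ht)
    | head hs _ ih =>
      intro x x' h h'
      obtain ⟨i, hi⟩ := hs
      obtain ⟨x₁, h1, h2⟩ := R_e' _ _ i _ h hi
      obtain ⟨x₂, h3, h4⟩ := R_e' _ _ i _ h' hi
      rw [ih x₁ x₂ h2 h4] at h1
      exact hC.e_injective h1 h3
  -- Descend from the unique highest weight element: equal `φ` allows the same lowering step in `C`,
  -- and `R_right` with injectivity of `e i` shows that it reaches the given `y`.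
  have R_surj : ∀ y, ∃ x, R x y := by
    intro y
    obtain ⟨t, hr, ht⟩ := hC'.exists_top wC' y
    induction hr using Relation.ReflTransGen.head_induction_on with
    | refl =>
      obtain ⟨x, -, hx⟩ := hC.exists_top wC (Classical.arbitrary B)
      obtain ⟨y, hy⟩ := total x
      exact ⟨x, uC' _ _ ((R_top _ _ hy).1 hx) ht ▸ hy⟩
    | head hs _ ih =>
      obtain ⟨i, hi⟩ := hs
      obtain ⟨x₁, hx₁⟩ := ih
      have h1 := sC'.phi_pos hC' hi
      rw [R_phi _ _ i hx₁] at h1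
      obtain ⟨x, hx⟩ := sC.exists_f i x₁ h1
      rw [hC.f_iff_e] at hx
      obtain ⟨y, hy⟩ := total x
      obtain ⟨y₁, h2, h3⟩ := R_e _ _ i _ hy hx
      rw [R_right _ _ _ h3 hx₁] at h2
      exact ⟨x, hC'.e_injective h2 hi ▸ hy⟩
  choose g hg using total
  have hbij : Function.Bijective g := by
    refine ⟨fun x x' h => R_left _ _ _ (hg x) (h ▸ hg x'), fun y => ?_⟩
    obtain ⟨x, hx⟩ := R_surj y
    exact ⟨x, R_right _ _ _ (hg x) hx⟩
  have map_e : ∀ i b, C'.e i (g b) = (C.e i b).map g := by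
    intro i b
    cases h : C.e i b with
    | none => exact (R_none b _ i (hg b)).1 h
    | some b' =>
      obtain ⟨y, h1, h2⟩ := R_e b _ i b' (hg b) h
      rw [h1, Option.map_some, R_right _ _ _ h2 (hg b')]
  refine ⟨⟨Equiv.ofBijective g hbij, fun b => R_wt _ _ (hg b), fun i b => R_eps _ _ i (hg b),
    fun i b => R_phi _ _ i (hg b), map_e, fun i b => ?_⟩⟩
  refine Option.ext fun y => ?_
  obtain ⟨b', rfl⟩ := hbij.2 y
  rw [Equiv.ofBijective_apply, hC'.f_iff_e, map_e, Option.map_eq_some_iff, Option.map_eq_some_iff]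
  constructor
  · rintro ⟨a, ha, hab⟩
    rw [hbij.1 hab] at ha
    exact ⟨b', (hC.f_iff_e _ _ _).2 ha, rfl⟩
  · rintro ⟨a, ha, hab⟩
    rw [hbij.1 hab] at ha
    exact ⟨b, (hC.f_iff_e _ _ _).1 ha, rfl⟩

end CrystalData

/-! ### Equivalence of arrays under column operators. -/

section ColEquiv

/-- Arrays with `n` rows and `m` columns that are connected by column operators. -/
def ColEquiv (n m : ℕ) : Arr → Arr → Prop :=
  Relation.EqvGen fun X Y => Good n m X ∧ Good n m Y ∧ ∃ j, j + 1 < m ∧ ColStep j X Y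

theorem ColStep.colEquiv {n m j : ℕ} {X Y : Arr} (hX : Good n m X) (hj : j + 1 < m)
    (h : ColStep j X Y) : ColEquiv n m X Y :=
  Relation.EqvGen.rel _ _ ⟨hX, h.good hj hX, j, hj, h⟩

theorem ColEquiv.height_le_iff {n m : ℕ} {X Y : Arr} (h : ColEquiv n m X Y) (i : ℕ) (z : ℤ) :
    (∀ k, height i X k ≤ z) ↔ ∀ k, height i Y k ≤ z := by
  induction h with
  | rel X Y h =>
    obtain ⟨hX, -, j, -, hs⟩ := h
    exact (hs.height_le_iff hX z).symm
  | refl => rfl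
  | symm _ _ _ ih => exact ih.symm
  | trans _ _ _ _ _ ih₁ ih₂ => exact ih₁.trans ih₂

theorem ColEquiv.rowSum_eq {n m : ℕ} {X Y : Arr} (h : ColEquiv n m X Y) (a : ℕ) :
    ∑ b ∈ Finset.range m, X a b = ∑ b ∈ Finset.range m, Y a b := by
  induction h with
  | rel X Y h =>
    obtain ⟨-, -, j, hj, hs⟩ := h
    exact (hs.rowSum_eq hj a).symm
  | refl => rfl
  | symm _ _ _ ih => exact ih.symm
  | trans _ _ _ _ _ ih₁ ih₂ => exact ih₁.trans ih₂

/-- Along a column step this is the diamond. Against it, preservation of row `ε` provides a row step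
at the source, and uniqueness of row steps identifies the far corner of the diamond. -/
theorem ColEquiv.rowStep {n m : ℕ} {X Y : Arr} (h : ColEquiv n m X Y) {i : ℕ} (hi : i + 1 < n) :
    (∀ K, RowStep i X K → ∃ K', RowStep i Y K' ∧ ColEquiv n m K K') ∧
    (∀ K, RowStep i Y K → ∃ K', RowStep i X K' ∧ ColEquiv n m K K') := by
  induction h with
  | rel X Y h =>
    obtain ⟨hX, hY, j, hj, hs⟩ := h
    constructor
    · intro K hK
      obtain ⟨W, h1, h2⟩ := hK.diamond hs
      exact ⟨W, h1, h2.colEquiv (hK.good hi hX) hj⟩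
    · intro K hK
      have hpos : ∃ k, 0 < height i X k := by
        obtain ⟨k, -, hp, -⟩ := hK
        by_contra! hc
        exact hp.not_ge ((hs.height_le_iff hX 0).2 hc k)
      obtain ⟨K₁, hK₁⟩ := exists_rowStep hX hpos
      obtain ⟨W, h1, h2⟩ := hK₁.diamond hs
      rw [h1.unique hK] at h2
      exact ⟨K₁, hK₁, Relation.EqvGen.symm _ _ (h2.colEquiv (hK₁.good hi hX) hj)⟩
  | refl X =>
    exact ⟨fun K hK => ⟨K, hK, Relation.EqvGen.refl _⟩,
      fun K hK => ⟨K, hK, Relation.EqvGen.refl _⟩⟩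
  | symm _ _ _ ih => exact ih.symm
  | trans _ _ _ _ _ ih₁ ih₂ =>
    constructor
    · intro K hK
      obtain ⟨K₁, h1, h2⟩ := ih₁.1 K hK
      obtain ⟨K₂, h3, h4⟩ := ih₂.1 K₁ h1
      exact ⟨K₂, h3, Relation.EqvGen.trans _ _ _ h2 h4⟩
    · intro K hK
      obtain ⟨K₁, h1, h2⟩ := ih₂.2 K hK
      obtain ⟨K₂, h3, h4⟩ := ih₁.2 K₁ h1
      exact ⟨K₂, h3, Relation.EqvGen.trans _ _ _ h2 h4⟩

/-- Each column raising step moves a unit one column to the left and lowers `∑ b * X a b` by one. -/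
theorem exists_colHighest {n m : ℕ} {X : Arr} (hX : Good n m X) : ∃ K, Good n m K ∧
    ColEquiv n m X K ∧ ∀ j, j + 1 < m → ∀ k, height j (tr K) k ≤ 0 := by
  induction hd : (∑ a ∈ Finset.range n, ∑ b ∈ Finset.range m, (b : ℤ) * X a b).toNat
    using Nat.strong_induction_on generalizing X with
  | _ d ih =>
    by_cases hc : ∀ j, j + 1 < m → ∀ k, height j (tr X) k ≤ 0
    · exact ⟨X, hX, Relation.EqvGen.refl _, hc⟩
    · push Not at hc
      obtain ⟨j, hj, hk⟩ := hc
      obtain ⟨Y, hs⟩ := exists_colStep hX hk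
      have hY := hs.good hj hX
      obtain ⟨l, hl, hp, hYX⟩ := colStep_iff.1 hs
      have hln : l < n := by
        have hpos := hl.entry_pos hX.tr hp
        by_contra hln
        rw [tr, hX.row_zero _ _ (not_lt.1 hln)] at hpos
        exact lt_irrefl _ hpos
      have hu : ∀ b < m, ∑ a ∈ Finset.range n, ∑ c ∈ Finset.range m,
          (c : ℤ) * unitArr l b a c = b := by
        intro b hb
        rw [Finset.sum_eq_single_of_mem l (Finset.mem_range.2 hln),
          Finset.sum_eq_single_of_mem b (Finset.mem_range.2 hb)]
        · simp [unitArr]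
        · intro c _ hcb; simp [unitArr, hcb]
        · intro a _ hal; simp [unitArr, hal]
      have hsum : ∑ a ∈ Finset.range n, ∑ b ∈ Finset.range m, (b : ℤ) * Y a b =
          ∑ a ∈ Finset.range n, ∑ b ∈ Finset.range m, (b : ℤ) * X a b - 1 := by
        have h1 := hu j (by omega)
        have h2 := hu (j + 1) hj
        rw [hYX]
        simp only [Pi.add_apply, Pi.sub_apply, mul_add, mul_sub, Finset.sum_add_distrib,
          Finset.sum_sub_distrib, h1, h2]
        push_cast
        ring
      have h0 : 0 ≤ ∑ a ∈ Finset.range n, ∑ b ∈ Finset.range m, (b : ℤ) * Y a b :=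
        Finset.sum_nonneg fun a _ => Finset.sum_nonneg fun b _ =>
          mul_nonneg (Int.natCast_nonneg _) (hY.nonneg a b)
      obtain ⟨K, h1, h2, h3⟩ := ih _ (by omega) hY rfl
      exact ⟨K, h1, Relation.EqvGen.trans _ _ _ (hs.colEquiv hX hj) h2, h3⟩

end ColEquiv

/-! ### Block arrays and the tensor product rule. -/

section Concat

/-- The array `A` with `n` columns, followed by the array `B`. -/
def concat (n : ℕ) (A B : Arr) : Arr := fun i j => if j < n then A i j else B i (j - n)

theorem concat_lt {n : ℕ} (A B : Arr) (i : ℕ) {j : ℕ} (h : j < n) : concat n A B i j = A i j :=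
  if_pos h

theorem concat_add {n : ℕ} (A B : Arr) (i j : ℕ) : concat n A B i (n + j) = B i j := by
  simp [concat]

theorem concat_good {n p m : ℕ} {A B : Arr} (hA : Good p n A) (hB : Good p m B) :
    Good p (n + m) (concat n A B) := by
  refine ⟨fun i j => ?_, fun i j hi => ?_, fun i j hj => ?_⟩
  · rw [concat]; split_ifs
    · exact hA.nonneg _ _
    · exact hB.nonneg _ _
  · rw [concat]; split_ifs
    · exact hA.row_zero _ _ hi
    · exact hB.row_zero _ _ hi
  · rw [concat, if_neg (by omega), hB.col_zero _ _ (by omega)]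

theorem sum_concat (n m : ℕ) (A B : Arr) (i : ℕ) : ∑ j ∈ Finset.range (n + m), concat n A B i j =
    ∑ j ∈ Finset.range n, A i j + ∑ j ∈ Finset.range m, B i j := by
  rw [Finset.sum_range_add]
  simp only [concat_add]
  congr 1
  exact Finset.sum_congr rfl fun j hj => concat_lt _ _ _ (Finset.mem_range.1 hj)

theorem height_concat_lt {n : ℕ} (A B : Arr) (i : ℕ) {k : ℕ} (h : k < n) :
    height i (concat n A B) k = height i A k := by
  rw [height, height]
  congr 1
  · refine Finset.sum_congr rfl fun j hj => concat_lt _ _ _ ?_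
    have := Finset.mem_range.1 hj; omega
  · refine Finset.sum_congr rfl fun j hj => concat_lt _ _ _ ?_
    have := Finset.mem_range.1 hj; omega

theorem height_concat_add {n p : ℕ} {A : Arr} (hA : Good p n A) (B : Arr) (i k : ℕ) :
    height i (concat n A B) (n + k) = height i A n + height i B k := by
  have h : height i A n = ∑ j ∈ Finset.range n, A (i + 1) j - ∑ j ∈ Finset.range n, A i j := by
    rw [height, Finset.sum_range_succ, hA.col_zero _ _ le_rfl, add_zero]
  rw [h, height, height, add_assoc, sum_concat, sum_concat]
  ring

theorem forall_height_concat {n p : ℕ} {A : Arr} (hA : Good p n A) (B : Arr) (i : ℕ)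
    (P : ℕ → ℤ → Prop) : (∀ k, P k (height i (concat n A B) k)) ↔
      (∀ k < n, P k (height i A k)) ∧ ∀ k, P (n + k) (height i A n + height i B k) := by
  constructor
  · intro h
    refine ⟨fun k hk => ?_, fun k => ?_⟩
    · rw [← height_concat_lt A B i hk]; exact h k
    · rw [← height_concat_add hA B i]; exact h _
  · rintro ⟨h1, h2⟩ k
    rcases lt_or_ge k n with hk | hk
    · rw [height_concat_lt A B i hk]; exact h1 k hk
    · obtain ⟨q, rfl⟩ := Nat.exists_eq_add_of_le hk
      rw [height_concat_add hA B i]; exact h2 q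

/-- The hypothesis `hB` says that the maximum over the right block does not exceed that over the
left. In a tie the first maximum is on the left, which gives the weak inequality in the tensor
product rule for `e`. -/
theorem RowStep.concat_left {i n p : ℕ} {A A' B : Arr} (hA : Good p n A) (h : RowStep i A A')
    (hB : ∀ z, (∀ k, height i A k ≤ z) → ∀ q, height i A n + height i B q ≤ z) :
    RowStep i (concat n A B) (concat n A' B) := by
  obtain ⟨k, hk, hp, rfl⟩ := h
  have hpos := hk.entry_pos hA hp
  have hkn : k < n := by
    by_contra hkn
    rw [hA.col_zero _ _ (not_lt.1 hkn)] at hpos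
    exact lt_irrefl _ hpos
  refine ⟨k, ?_, by rwa [height_concat_lt A B i hkn], ?_⟩
  · rw [FirstMax, height_concat_lt A B i hkn]
    refine ⟨fun l hl => ?_, ?_⟩
    · rw [height_concat_lt A B i (hl.trans hkn)]
      exact hk.1 l hl
    · rw [forall_height_concat hA B i fun _ z => z ≤ height i A k]
      exact ⟨fun l _ => hk.2 l, hB _ hk.2⟩
  · funext a b
    simp only [concat, Pi.add_apply, Pi.sub_apply, unitArr]
    split_ifs <;> first | rfl | omega

/-- Here `hB` says that the maximum over the right block is strictly larger, so it is first attained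
there. -/
theorem RowStep.concat_right {i n p : ℕ} {A B B' : Arr} (hA : Good p n A) (h : RowStep i B B')
    (hB : ∀ z, (∀ k, height i B k ≤ z) → ∀ q, height i A q < height i A n + z) :
    RowStep i (concat n A B) (concat n A B') := by
  obtain ⟨k, hk, hp, rfl⟩ := h
  have hlt := hB _ hk.2
  refine ⟨n + k, ?_, ?_, ?_⟩
  · rw [FirstMax, height_concat_add hA]
    refine ⟨?_, ?_⟩
    · rw [forall_height_concat hA B i fun l z => l < n + k → z < height i A n + height i B k]
      refine ⟨fun l _ _ => hlt l, fun l hl => ?_⟩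
      have := hk.1 l (by omega)
      omega
    · rw [forall_height_concat hA B i fun _ z => z ≤ height i A n + height i B k]
      refine ⟨fun l _ => (hlt l).le, fun l => ?_⟩
      have := hk.2 l
      omega
  · rw [height_concat_add hA]
    have h1 := hlt 0
    rw [height_zero] at h1
    have := hA.nonneg (i + 1) 0
    omega
  · funext a b
    simp only [concat, Pi.add_apply, Pi.sub_apply, unitArr]
    split_ifs <;> first | rfl | omega

theorem ColStep.concat_left {j n : ℕ} {A A' : Arr} (B : Arr) (hj : j + 1 < n)
    (h : ColStep j A A') : ColStep j (concat n A B) (concat n A' B) := by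
  obtain ⟨l, hl, hp, rfl⟩ := colStep_iff.1 h
  have hh : height j (tr (concat n A B)) = height j (tr A) := by
    funext k
    simp only [height, tr, concat_lt A B _ hj, concat_lt A B _ (show j < n by omega)]
  refine colStep_iff.2 ⟨l, by rwa [hh], by rwa [hh], ?_⟩
  funext a b
  simp only [concat, Pi.add_apply, Pi.sub_apply, unitArr]
  split_ifs <;> first | rfl | omega

theorem ColStep.concat_right {j n : ℕ} (A : Arr) {B B' : Arr} (h : ColStep j B B') :
    ColStep (n + j) (concat n A B) (concat n A B') := by
  obtain ⟨l, hl, hp, rfl⟩ := colStep_iff.1 h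
  have hh : height (n + j) (tr (concat n A B)) = height j (tr B) := by
    funext k
    simp only [height, tr, add_assoc, concat_add]
  refine colStep_iff.2 ⟨l, by rwa [hh], by rwa [hh], ?_⟩
  funext a b
  simp only [concat, Pi.add_apply, Pi.sub_apply, unitArr]
  split_ifs <;> first | rfl | omega

end Concat

open CrystalData

/-! ### The correspondence between matrices and tableaux, and the components. -/

section Main

variable {n : ℕ}

/-- The array `[M | Mᵗ]`. -/
def doubleArr (M : Mat n) : Arr := concat n (toArr M) (tr (toArr M))

theorem doubleArr_good (M : Mat n) : Good n (n + n) (doubleArr M) :=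
  concat_good (toArr_good M) (toArr_good M).tr

theorem diagEps_le_iff (i : Fin (n - 1)) (M : Mat n) (z : ℤ) :
    (diagCrystal n).eps i M ≤ z ↔ ∀ k, height i (doubleArr M) k ≤ z := by
  have hc := colEps_le_iff i M (z - height i (toArr M) n)
  have hr : (rowCrystal n).eps i M ≤ z ↔ 0 ≤ z ∧ ∀ k < n, height i (toArr M) k ≤ z := by
    rw [rowEps_le_iff, height_le_iff (toArr_good M)]
  have hz := height_toArr_eq i M
  have h1 : (diagCrystal n).eps i M ≤ z ↔ (rowCrystal n).eps i M ≤ z ∧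
      (colCrystal n).eps i M ≤ z - height i (toArr M) n := by
    simp only [diagCrystal, max_le_iff]
    omega
  rw [h1, hr, hc, doubleArr, forall_height_concat (toArr_good M) _ _ fun _ h => h ≤ z]
  constructor
  · rintro ⟨⟨-, h2⟩, h3⟩
    exact ⟨h2, fun k => by have := h3 k; omega⟩
  · rintro ⟨h2, h3⟩
    refine ⟨⟨?_, h2⟩, fun k => by have := h3 k; omega⟩
    have h4 := h2 0 (by have := lt_of_index i; omega)
    rw [height_zero] at h4
    exact ((toArr_good M).nonneg _ _).trans h4

/-- The row operator on `[M | Mᵗ]` changes the block selected by the tensor product rule. A row step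
of `M` is a column step of `Mᵗ` and conversely, so one column step repairs the other block. -/
theorem diagE_rowStep {i : Fin (n - 1)} {M M' : Mat n} (h : (diagCrystal n).e i M = some M') :
    ∃ K, RowStep i (doubleArr M) K ∧ ColEquiv n (n + n) K (doubleArr M') := by
  have hi := lt_of_index i
  have hA := toArr_good M
  have hz := height_toArr_eq i M
  have hphi := rowCrystal_isCrystal.phi_eq i M
  rcases diagE_eq_some_iff.1 h with ⟨h1, h2⟩ | ⟨h1, h2⟩
  · have hs := rowE_iff.1 h2
    have hK : RowStep i (doubleArr M) (concat n (toArr M') (tr (toArr M))) := by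
      refine hs.concat_left hA fun z hzz q => ?_
      have h3 := (rowEps_le_iff i M z).2 hzz
      have h4 := (colEps_le_iff i M _).1 le_rfl q
      omega
    refine ⟨_, hK, ColStep.colEquiv (hK.good hi (doubleArr_good M)) (j := n + i) (by omega) ?_⟩
    exact ColStep.concat_right _ hs
  · have hs := colE_iff.1 h2
    have hK : RowStep i (doubleArr M) (concat n (toArr M) (tr (toArr M'))) := by
      refine RowStep.concat_right hA hs fun z hzz q => ?_
      have h3 := (colEps_le_iff i M z).2 hzz
      have h4 := (rowEps_le_iff i M _).1 le_rfl q
      omega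
    refine ⟨_, hK, ColStep.colEquiv (hK.good hi (doubleArr_good M)) (j := i) (by omega) ?_⟩
    exact ColStep.concat_left _ hi hs

/-- A matrix `M` corresponds to the tableau which the column operators produce from
`[M | Mᵗ]`. -/
def Corr (M : Mat n) {l : Partn n} (T : Tableau l) : Prop :=
  ColEquiv n (n + n) (doubleArr M) (tabArr T)

/-- A column-highest array vanishes above the diagonal; having only `n` rows, it is supported in the
first `n` columns and comes from a tableau. -/
theorem exists_corr (hn : 0 < n) (M : Mat n) : ∃ (l : Partn n) (T : Tableau l), Corr M T := by
  obtain ⟨K, hK, hMK, hh⟩ := exists_colHighest (doubleArr_good M)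
  have hz := eq_zero_of_colHighest hK hh
  have hg : Good n n K := by
    refine ⟨hK.nonneg, hK.row_zero, fun i j hj => ?_⟩
    rcases lt_or_ge i n with hi | hi
    · exact hz i j (by omega)
    · exact hK.row_zero i j hi
  have hh' : ∀ j, j + 1 < n → ∀ k, height j (tr K) k ≤ 0 := fun j hj => hh j (by omega)
  obtain ⟨l, hl⟩ := exists_shape hg hh'
  obtain ⟨T, rfl⟩ := exists_tabArr hn hg hh' hl
  exact ⟨l, T, hMK⟩

theorem Corr.eps_eq {M : Mat n} {l : Partn n} {T : Tableau l} (h : Corr M T) (i : Fin (n - 1)) :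
    (tableauCrystal l).eps i T = (diagCrystal n).eps i M := by
  refine eq_of_forall_ge_iff fun z => ?_
  rw [tabEps_le_iff, diagEps_le_iff, h.height_le_iff]

theorem Corr.wt_eq {M : Mat n} {l : Partn n} {T : Tableau l} (h : Corr M T) :
    (tableauCrystal l).wt T = (diagCrystal n).wt M := by
  funext a
  have h1 := h.rowSum_eq a
  rw [doubleArr, sum_concat, Finset.sum_range_add,
    Finset.sum_eq_zero (s := Finset.range n) (f := fun x => tabArr T a (n + x))
      fun j _ => (tabArr_good T).col_zero _ _ (Nat.le_add_right _ _), add_zero] at h1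
  rw [tabWt_apply, ← h1]
  simp only [diagCrystal, Pi.add_apply, rowWt_apply, colWt_apply, Finset.sum_range, tr,
    toArr_apply]

theorem Corr.e {M M' : Mat n} {l : Partn n} {T : Tableau l} (h : Corr M T) {i : Fin (n - 1)}
    (hM : (diagCrystal n).e i M = some M') :
    ∃ T', (tableauCrystal l).e i T = some T' ∧ Corr M' T' := by
  obtain ⟨K, h1, h2⟩ := diagE_rowStep hM
  obtain ⟨K', h3, h4⟩ := (ColEquiv.rowStep h (lt_of_index i)).1 K h1
  obtain ⟨T', rfl⟩ := h3.exists_tableau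
  exact ⟨T', tabE_iff.2 h3, Relation.EqvGen.trans _ _ _ (Relation.EqvGen.symm _ _ h2) h4⟩

theorem Corr.raise {M M' : Mat n} (hr : (diagCrystal n).Raise M M') {l : Partn n} {T : Tableau l}
    (h : Corr M T) : ∃ T' : Tableau l, Corr M' T' := by
  induction hr with
  | refl => exact ⟨T, h⟩
  | tail _ hs ih =>
    obtain ⟨T₁, h1⟩ := ih
    obtain ⟨i, hi⟩ := hs
    obtain ⟨T₂, -, h2⟩ := h1.e hi
    exact ⟨T₂, h2⟩

theorem Corr.isTop {M : Mat n} {l : Partn n} {T : Tableau l} (h : Corr M T)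
    (hM : (diagCrystal n).IsTop M) : (tableauCrystal l).IsTop T := fun i =>
  (tableauCrystal_isSeminormal l).e_eq_none (tableauCrystal_isCrystal l)
    ((h.eps_eq i).trans (diagCrystal_isSeminormal.eps_eq_zero (hM i)))

/-- The diagonal array of a partition. -/
def diagArr (l : Partn n) : Arr := fun i j => if i = j then (l.rowLen i : ℤ) else 0

theorem toArr_diagonal (l : Partn n) : toArr (Matrix.diagonal l.1) = diagArr l := by
  funext i j
  simp only [toArr, diagArr, Matrix.diagonal_apply, Fin.mk.injEq, Partn.rowLen]
  split_ifs <;> first | rfl | omega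

theorem Partn.rowLen_succ_le (l : Partn n) (i : ℕ) : l.rowLen (i + 1) ≤ l.rowLen i := by
  simp only [rowLen]
  split_ifs with h1 h2 h2
  · exact l.2 (Fin.mk_le_mk.2 (Nat.le_succ i))
  · omega
  · exact Nat.zero_le _
  · exact le_rfl

theorem height_diagArr_le (l : Partn n) (i k : ℕ) : height i (diagArr l) k ≤ 0 := by
  have h := l.rowLen_succ_le i
  simp only [height, diagArr, Finset.sum_ite_eq, Finset.mem_range]
  split_ifs <;> omega

theorem tr_diagArr (l : Partn n) : tr (diagArr l) = diagArr l := by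
  funext i j
  simp only [tr, diagArr]
  by_cases h : i = j
  · subst h; rfl
  · rw [if_neg h, if_neg (Ne.symm h)]

theorem diagonal_isTop (l : Partn n) : (diagCrystal n).IsTop (Matrix.diagonal l.1) := by
  intro i
  refine diagCrystal_isSeminormal.e_eq_none diagCrystal_isCrystal
    (le_antisymm ?_ (diagCrystal_isSeminormal.eps_nonneg _ _))
  rw [diagEps_le_iff, doubleArr,
    forall_height_concat (toArr_good _) _ _ fun _ h => h ≤ 0, toArr_diagonal, tr_diagArr]
  refine ⟨fun k _ => height_diagArr_le l i k, fun k => ?_⟩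
  have h1 := height_diagArr_le l i k
  have h2 := height_diagArr_le l i n
  omega

theorem diagonal_mem_lowerMat (l : Partn n) : Matrix.diagonal l.1 ∈ lowerMat n :=
  fun _ _ hij => Matrix.diagonal_apply_ne _ hij.ne

theorem eq_diagArr {l : Partn n} {X : Arr} (hX : Good n n X) (h : ∀ i j, i ≠ j → X i j = 0)
    (hs : ∀ j < n, ∑ a ∈ Finset.range n, X a j = l.rowLen j) : X = diagArr l := by
  funext i j
  rw [diagArr]
  split_ifs with hij
  · subst hij
    rcases lt_or_ge i n with hi | hi
    · rw [← hs i hi, Finset.sum_eq_single_of_mem i (Finset.mem_range.2 hi)]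
      exact fun a _ ha => h a i ha
    · rw [hX.row_zero _ _ hi, Partn.rowLen, dif_neg (not_lt.2 hi)]
      rfl
  · exact h i j hij

/-- The array is row-highest and column-highest, hence diagonal, and its column sums are known. -/
theorem tabArr_eq_diagArr {l : Partn n} {T : Tableau l} (h : (tableauCrystal l).IsTop T) :
    tabArr T = diagArr l := by
  have hX := tabArr_good T
  have h1 := eq_zero_of_colHighest hX fun j _ => tabArr_colHighest T j
  have h2 := eq_zero_of_rowHighest hX fun i hi => by
    have := (tableauCrystal_isSeminormal l).eps_eq_zero (h ⟨i, by omega⟩)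
    exact (tabEps_le_iff ⟨i, by omega⟩ T 0).1 this.le
  refine eq_diagArr hX (fun i j hij => ?_) fun j _ => colSum_tabArr T j
  rcases lt_or_gt_of_ne hij with hij | hij
  · exact h1 i j hij
  · exact h2 i j hij

theorem tableau_isTop_unique {l : Partn n} (T T' : Tableau l) (h : (tableauCrystal l).IsTop T)
    (h' : (tableauCrystal l).IsTop T') : T = T' :=
  tabArr_injective l ((tabArr_eq_diagArr h).trans (tabArr_eq_diagArr h').symm)

theorem lowerMat_stable : (diagCrystal n).Stable (lowerMat n) := fun _ _ hb =>
  ⟨fun _ h => lower_of_diagE hb h, fun _ h => lower_of_diagF hb (diagF_iff_diagE.1 h)⟩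

/-- The diagonal `ε` bounds the row `ε`, so `M` is row-highest and vanishes below the diagonal;
row-highestness also orders the diagonal entries. -/
theorem exists_eq_diagonal {M : Mat n} (hM : M ∈ lowerMat n) (ht : (diagCrystal n).IsTop M) :
    ∃ l : Partn n, M = Matrix.diagonal l.1 := by
  have hX := toArr_good M
  have hrow : ∀ i, i + 1 < n → ∀ k, height i (toArr M) k ≤ 0 := by
    intro i hi
    have h1 := diagCrystal_isSeminormal.eps_eq_zero (ht ⟨i, by omega⟩)
    exact (rowEps_le_iff ⟨i, by omega⟩ M 0).1 ((le_max_left _ _).trans h1.le)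
  have hd : ∀ i j, i ≠ j → toArr M i j = 0 := by
    intro i j hij
    rcases lt_or_gt_of_ne hij with hij | hij
    · exact mem_lowerMat_iff.1 hM i j hij
    · exact eq_zero_of_rowHighest hX hrow i j hij
  obtain ⟨l, hl⟩ := exists_shape hX.tr hrow
  refine ⟨l, toArr_injective ?_⟩
  rw [toArr_diagonal, ← tr_diagArr, ← eq_diagArr hX.tr (fun i j hij => hd j i hij.symm) hl, tr_tr]

theorem exists_raise_diagonal {M : Mat n} (hM : M ∈ lowerMat n) :
    ∃ l : Partn n, (diagCrystal n).Raise M (Matrix.diagonal l.1) := by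
  obtain ⟨t, hr, ht⟩ := diagCrystal_isCrystal.exists_top diagWt_nonneg M
  obtain ⟨hc, -⟩ := raise_restrict lowerMat_stable hr hM
  obtain ⟨l, rfl⟩ := exists_eq_diagonal hc ht
  exact ⟨l, hr⟩

/-- Raising keeps the shape `m` and leads to the highest weight tableau, of weight `m`; the weight
of `diag(l)` in the diagonal crystal is `2l`. -/
theorem Corr.shape_eq {M : Mat n} {l m : Partn n} {T : Tableau m} (h : Corr M T)
    (hr : (diagCrystal n).Raise M (Matrix.diagonal l.1)) : m = l.double := by
  obtain ⟨T', h'⟩ := h.raise hr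
  have h1 := tabArr_eq_diagArr (h'.isTop (diagonal_isTop l))
  refine Subtype.ext (funext fun a => ?_)
  have h2 := congrFun h'.wt_eq a
  rw [tabWt_apply, h1] at h2
  simp only [diagArr, Finset.sum_ite_eq, Finset.mem_range, a.2, if_true, Partn.rowLen_coe,
    diagCrystal, Pi.add_apply, rowWt_apply, colWt_apply, Matrix.diagonal_apply, Nat.cast_ite,
    Nat.cast_zero, Finset.sum_ite_eq', Finset.mem_univ] at h2
  change m.1 a = 2 * l.1 a
  omega

theorem Partn.double_injective : Function.Injective (Partn.double : Partn n → Partn n) := by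
  intro l m h
  refine Subtype.ext (funext fun a => ?_)
  have : 2 * l.1 a = 2 * m.1 a := congrFun (congrArg Subtype.val h) a
  omega

/-- Lower triangular matrices that correspond to a tableau of shape `2 λ`. -/
def HasShape (l : Partn n) (M : Mat n) : Prop :=
  M ∈ lowerMat n ∧ ∃ T : Tableau l.double, Corr M T

theorem hasShape_diagonal (hn : 0 < n) (l : Partn n) : HasShape l (Matrix.diagonal l.1) := by
  refine ⟨diagonal_mem_lowerMat l, ?_⟩
  obtain ⟨m, T, h⟩ := exists_corr hn (Matrix.diagonal l.1)
  obtain rfl := h.shape_eq Relation.ReflTransGen.refl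
  exact ⟨T, h⟩

theorem HasShape.raise {l : Partn n} {M : Mat n} (h : HasShape l M) :
    (diagCrystal n).Raise M (Matrix.diagonal l.1) := by
  obtain ⟨hM, T, hT⟩ := h
  obtain ⟨m, hm⟩ := exists_raise_diagonal hM
  rwa [Partn.double_injective (hT.shape_eq hm)]

theorem hasShape_iff_of_e {l : Partn n} {i : Fin (n - 1)} {M M' : Mat n}
    (h : (diagCrystal n).e i M = some M') : HasShape l M ↔ HasShape l M' := by
  constructor
  · rintro ⟨hM, T, hT⟩
    obtain ⟨T', -, hT'⟩ := hT.e h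
    exact ⟨lower_of_diagE hM h, T', hT'⟩
  · intro hM'
    refine ⟨lower_of_diagF hM'.1 h, ?_⟩
    -- Some tableau corresponds to `M`; its shape is read off after applying `e i`, since `M'`
    -- raises to the diagonal matrix.
    obtain ⟨m, T, hT⟩ := exists_corr (by have := lt_of_index i; omega) M
    obtain ⟨T₁, -, hT₁⟩ := hT.e h
    obtain rfl := hT₁.shape_eq hM'.raise
    exact ⟨T, hT⟩

theorem hasShape_of_mem (hn : 0 < n) {l : Partn n} {M : Mat n} (h : M ∈ diagComponent l) :
    HasShape l M := by
  have key : ∀ X Y : Mat n,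
      Relation.EqvGen (fun y z => ∃ i, (diagCrystal n).f i y = some z ∨
        (diagCrystal n).e i y = some z) X Y → (HasShape l X ↔ HasShape l Y) := by
    intro X Y hXY
    induction hXY with
    | rel X Y h =>
      obtain ⟨i, hi | hi⟩ := h
      · exact (hasShape_iff_of_e (diagF_iff_diagE.1 hi)).symm
      · exact hasShape_iff_of_e hi
    | refl => rfl
    | symm _ _ _ ih => exact ih.symm
    | trans _ _ _ _ _ ih₁ ih₂ => exact ih₁.trans ih₂
  exact (key _ _ h).1 (hasShape_diagonal hn l)

theorem mem_component_of_raise {C : CrystalData n (Mat n)} {M M' : Mat n} (h : C.Raise M M') :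
    M ∈ C.component M' := by
  refine Relation.EqvGen.symm _ _ ?_
  induction h with
  | refl => exact Relation.EqvGen.refl _
  | tail _ h ih =>
    obtain ⟨i, hi⟩ := h
    exact Relation.EqvGen.trans _ _ _ ih (Relation.EqvGen.rel _ _ ⟨i, Or.inr hi⟩)

theorem diagComponent_stable (l : Partn n) : (diagCrystal n).Stable (diagComponent l) :=
  fun i _ hb =>
    ⟨fun _ h => Relation.EqvGen.trans _ _ _ hb (Relation.EqvGen.rel _ _ ⟨i, Or.inr h⟩),
      fun _ h => Relation.EqvGen.trans _ _ _ hb (Relation.EqvGen.rel _ _ ⟨i, Or.inl h⟩)⟩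

theorem diagComponent_iso (hn : 0 < n) (l : Partn n) : Nonempty
    (Iso ((diagCrystal n).restrict (diagComponent l)) (tableauCrystal l.double)) := by
  have hC : ((diagCrystal n).restrict (diagComponent l)).IsCrystal :=
    diagCrystal_isCrystal.comap Subtype.val_injective
  have sC := diagCrystal_isSeminormal.restrict (diagComponent_stable l)
  have : Nonempty (diagComponent l) := ⟨⟨Matrix.diagonal l.1, Relation.EqvGen.refl _⟩⟩
  have htop : ∀ b, ((diagCrystal n).restrict (diagComponent l)).IsTop b →
      b.1 = Matrix.diagonal l.1 := by
    intro b hb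
    -- Every element of the component raises to `diag(l)`, so a highest weight element is already
    -- equal to it.
    refine IsTop.eq_of_raise (fun i => ?_) (hasShape_of_mem hn b.2).raise
    exact diagCrystal_isSeminormal.e_eq_none diagCrystal_isCrystal (sC.eps_eq_zero (hb i))
  refine nonempty_iso hC (tableauCrystal_isCrystal _) sC (tableauCrystal_isSeminormal _)
    (fun b => diagWt_nonneg b.1) (fun T a => ?_)
    (fun b c hb hc => Subtype.ext ((htop b hb).trans (htop c hc).symm)) tableau_isTop_unique
    (fun b T => Corr b.1 T) (fun b => (hasShape_of_mem hn b.2).2) (fun _ _ h => h.wt_eq)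
    (fun _ _ i h => h.eps_eq i) (fun b T i b' h hb => h.e ((comap_e_eq_some
      Subtype.val_injective).1 hb))
  rw [tabWt_apply]
  exact Finset.sum_nonneg fun j _ => (tabArr_good T).nonneg _ _

theorem lowerMat_eq (hn : 0 < n) : lowerMat n = ⋃ l : Partn n, diagComponent l := by
  ext M
  rw [Set.mem_iUnion]
  constructor
  · intro hM
    obtain ⟨l, hl⟩ := exists_raise_diagonal hM
    exact ⟨l, mem_component_of_raise hl⟩
  · rintro ⟨l, hl⟩
    exact (hasShape_of_mem hn hl).1

theorem diagComponent_disjoint (hn : 0 < n) {l m : Partn n} (h : l ≠ m) :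
    Disjoint (diagComponent l) (diagComponent m) := by
  rw [Set.disjoint_left]
  intro M hl hm
  obtain ⟨-, T, hT⟩ := hasShape_of_mem hn hm
  exact h (Partn.double_injective (hT.shape_eq (hasShape_of_mem hn hl).raise)).symm

end Main

end DiagCrystal

theorem lemma3p2 (n : ℕ) (hn : 2 ≤ n) :
    (DiagCrystal.diagCrystal n).Stable (DiagCrystal.lowerMat n) ∧
    (DiagCrystal.diagCrystal n).IsSubcrystal (DiagCrystal.lowerMat n) ∧
    (DiagCrystal.lowerMat n = ⋃ l : DiagCrystal.Partn n, DiagCrystal.diagComponent l) ∧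
    (∀ l m : DiagCrystal.Partn n, l ≠ m →
      Disjoint (DiagCrystal.diagComponent l) (DiagCrystal.diagComponent m)) ∧
    (∀ l : DiagCrystal.Partn n,
      Nonempty (DiagCrystal.CrystalData.Iso
        ((DiagCrystal.diagCrystal n).restrict (DiagCrystal.diagComponent l))
        (DiagCrystal.tableauCrystal l.double))) := by
  have h0 : 0 < n := by omega
  exact ⟨DiagCrystal.lowerMat_stable,
    ⟨DiagCrystal.diagCrystal_isCrystal, DiagCrystal.lowerMat_stable,
      DiagCrystal.diagCrystal_isCrystal.comap Subtype.val_injective⟩,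
    DiagCrystal.lowerMat_eq h0, fun _ _ h => DiagCrystal.diagComponent_disjoint h0 h,
    DiagCrystal.diagComponent_iso h0⟩
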